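/- Let $a,b\ge 1$ be integers, $m=a+b$ and $\alpha\in[0,1]$. Let $\{U(t,i):t,i\in\mathbb N\}$ be i.i.d. random variables, uniformly distributed on $[0,1]$. For each $N\ge 1$ consider $N$ urns, each containing $a$ red and $b$ white balls at time $0$. Let $X^N_t(i)$ be the number of red balls in urn $i$ at time $t$, $Z^N_t(i)=\frac{X^N_t(i)}{t+m}$ and $Z^N_t=\frac1N\sum_{i=1}^N Z^N_t(i)$; thus $X^N_0(i)=a$, and for $t\ge 0$ and $1\le i\le N$ $$X^N_{t+1}(i)=X^N_t(i)+\mathbf 1_{\{U(t+1,i)\le \alpha Z^N_t+(1-\alpha)Z^N_t(i)\}} .$$ Set $W^N_t=\sqrt N\left(Z^N_t-\frac am\right)$. Let $(x^\infty_t)_{t\ge 0}$ be the solution of $x^\infty_0=0$ and $$x^\infty_{t+1}=x^\infty_t-\frac{2\alpha}{t+m+1}x^\infty_t+\frac{2\alpha-1}{(t+m+1)^2}x^\infty_t+\frac{1}{(t+m+1)^2}\left(\frac am-\frac{a^2}{m^2}\right).$$ **Theorem.** For every $t\ge 0$, $$\sigma_t^2:=\frac{1}{(t+m+1)^2}\left(\left[\frac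 am-\frac{a^2}{m^2}\right]-(1-\alpha)^2x^\infty_t\right)\ge 0 .$$ Let $\sigma_t\ge 0$ be its square root. If $(B_t)_{t\ge 1}$ are i.i.d. standard normal random variables, then the process $W=(W_t)_{t\ge 0}$ defined by $$W_0=0,\qquad W_{t+1}=W_t+\sigma_tB_{t+1}\quad(t\ge 0)$$ is a Gaussian process and a Markov process, and the processes $(W^N_t)_{t\ge 0}$ converge weakly to $W$ as $N\to\infty$, that is, their laws on $\mathbb R^{\mathbb N}$ with the product topology converge weakly to the law of $W$. -/

import Mathlib

open MeasureTheory ProbabilityTheory Filter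

namespace PolyaUrns

/-- The average of the numbers `z 1, …, z N`. -/
noncomputable def average (N : ℕ) (z : ℕ → ℝ) : ℝ :=
  (∑ i ∈ Finset.Icc 1 N, z i) / N

/-- The fraction of red balls at time `t` in an urn which contains `x` of them, if every urn starts
with `a` red and `b` white balls and one ball is added at each time step. -/
noncomputable def fraction (a b t x : ℕ) : ℝ :=
  (x : ℝ) / ((t : ℝ) + ((a : ℝ) + (b : ℝ)))

/-- `redBalls a b α N U t i ω`: the number of red balls in urn `i` (`1 ≤ i ≤ N`) at time `t`, in the
system of `N` urns driven by the variables `U`. At time `t + 1`, urn `i` receives a red ball if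
`U (t + 1) i ≤ α Z + (1 - α) Z_i`, and a white one otherwise, where `Z_i` is the fraction of red
balls in urn `i` at time `t` and `Z` is the average of `Z_1, …, Z_N`. -/
noncomputable def redBalls {Ω : Type*} (a b : ℕ) (α : ℝ) (N : ℕ) (U : ℕ → ℕ → Ω → ℝ) :
    ℕ → ℕ → Ω → ℕ
  | 0, _, _ => a
  | t + 1, i, ω =>
      redBalls a b α N U t i ω +
        if U (t + 1) i ω ≤
            α * average N (fun j => fraction a b t (redBalls a b α N U t j ω)) +
              (1 - α) * fraction a b t (redBalls a b α N U t i ω)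
        then 1 else 0

/-- The total fraction `Z_t^N` of red balls at time `t` in the system of `N` urns. -/
noncomputable def totalFraction {Ω : Type*} (a b : ℕ) (α : ℝ) (N : ℕ) (U : ℕ → ℕ → Ω → ℝ)
    (t : ℕ) (ω : Ω) : ℝ :=
  average N (fun i => fraction a b t (redBalls a b α N U t i ω))

/-- The rescaled fluctuation `W_t^N = √N (Z_t^N - a / m)`, where `m = a + b`. -/
noncomputable def fluctuation {Ω : Type*} (a b : ℕ) (α : ℝ) (N : ℕ) (U : ℕ → ℕ → Ω → ℝ)
    (t : ℕ) (ω : Ω) : ℝ :=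
  √(N : ℝ) * (totalFraction a b α N U t ω - (a : ℝ) / ((a : ℝ) + (b : ℝ)))

/-- The solution `x_t^∞` of the limiting variance recursion, with `x_0^∞ = 0`. -/
noncomputable def xInf (a b : ℕ) (α : ℝ) : ℕ → ℝ
  | 0 => 0
  | t + 1 =>
      xInf a b α t
        - 2 * α / ((t : ℝ) + ((a : ℝ) + (b : ℝ)) + 1) * xInf a b α t
        + (2 * α - 1) / ((t : ℝ) + ((a : ℝ) + (b : ℝ)) + 1) ^ 2 * xInf a b α t
        + 1 / ((t : ℝ) + ((a : ℝ) + (b : ℝ)) + 1) ^ 2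
          * ((a : ℝ) / ((a : ℝ) + (b : ℝ)) - (a : ℝ) ^ 2 / ((a : ℝ) + (b : ℝ)) ^ 2)

/-- The variance `σ_t ^ 2` of the increment of the limit process between times `t` and `t + 1`. -/
noncomputable def sigmaSq (a b : ℕ) (α : ℝ) (t : ℕ) : ℝ :=
  1 / ((t : ℝ) + ((a : ℝ) + (b : ℝ)) + 1) ^ 2
    * (((a : ℝ) / ((a : ℝ) + (b : ℝ)) - (a : ℝ) ^ 2 / ((a : ℝ) + (b : ℝ)) ^ 2)
      - (1 - α) ^ 2 * xInf a b α t)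

/-- The solution of `W_0 = 0`, `W_{t+1} = W_t + σ_t B_{t+1}`, where `σ_t = √(σ_t ^ 2)`. -/
noncomputable def limitProcess {Ω : Type*} (a b : ℕ) (α : ℝ) (B : ℕ → Ω → ℝ) : ℕ → Ω → ℝ
  | 0, _ => 0
  | t + 1, ω => limitProcess a b α B t ω + √(sigmaSq a b α t) * B (t + 1) ω

/-- The Markov property of a real process `W` in discrete time, with respect to its own history:
for `s ≤ t`, the conditional law of `W t` given `W 0, …, W s` is its conditional law given `W s`
alone. The variables `W t` are required to be measurable, so that the σ-algebras which they
generate are sub-σ-algebras of `mΩ`. -/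
def IsMarkovProcess {Ω : Type*} [mΩ : MeasurableSpace Ω] (W : ℕ → Ω → ℝ) (μ : Measure Ω) :
    Prop :=
  (∀ t, Measurable (W t)) ∧
  ∀ s t : ℕ, s ≤ t → ∀ A : Set ℝ, MeasurableSet A →
    μ[(W t ⁻¹' A).indicator (fun _ => (1 : ℝ)) |
        ⨆ r ∈ Set.Iic s, MeasurableSpace.comap (W r) inferInstance]
      =ᵐ[μ] μ[(W t ⁻¹' A).indicator (fun _ => (1 : ℝ)) |
        MeasurableSpace.comap (W s) inferInstance]

end PolyaUrns

/-! The draw probability of urn `i` is `p_i = α Z + (1 - α) Z_i`, and the average of the `p_i` is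
`Z`. So `Z^N` is a martingale: with `m = a + b`, its increment is `1 / (t + m + 1)` times the
average of the noises `1_{U ≤ p_i} - p_i`, which given the past are independent centred Bernoulli
variables (`totalFraction_succ`, `integral_mul_prod_exp_bernoulliNoise`).

Hence `W_{t+1}^N - W_t^N` is a normalised sum of `N` such variables with conditional variance
`(average of p_i (1 - p_i)) / (t + m + 1)^2`. Since `p_i - Z = (1 - α) (Z_i - Z)`, that average is
`Z - Z^2 - (1 - α)^2 (M - Z^2)`, where `M` is the average of the `Z_i^2` (`average_drawProb_mul`).
Noises of distinct urns are orthogonal, so their averages vanish in mean. Induction on `t` gives `Z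
→ a/m` and `M → x_t^∞ + (a/m)^2` (`tendstoInMean_fractions`), and the conditional variance tends to
the constant `σ_t^2`.

Comparing each Bernoulli characteristic function with a Gaussian one shows that the increment is
asymptotically Gaussian and independent of the past (`tendsto_integral_exp_fluctuation_succ`).
Induction on `t` yields the characteristic functions of all finite-dimensional distributions. On
`ℝ^ℕ` this suffices, since every open set is an increasing union of open cylinders
(`tendstoInDistribution_of_tendsto_charFun`).

The limit has independent Gaussian increments, hence is Gaussian and Markov. Finally `σ_t^2 ≥ 0`
because `x_t^∞` stays between `0` and `a/m - (a/m)^2` (`xInf_mem_Icc`). -/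

namespace PolyaUrns

open scoped Topology

/-! ### Independent σ-algebras and integrating out one uniform variable. -/

section Independence

/-- The σ-algebra generated by the variables `U i` with `i ∈ S`. -/
@[reducible]
def generated {Ω ι : Type*} (U : ι → Ω → ℝ) (S : Set ι) : MeasurableSpace Ω :=
  ⨆ i ∈ S, MeasurableSpace.comap (U i) inferInstance

variable {Ω ι : Type*} {U : ι → Ω → ℝ} {S T : Set ι}

lemma generated_mono (h : S ⊆ T) : generated U S ≤ generated U T :=
  biSup_mono h

lemma measurable_generated {i : ι} (hi : i ∈ S) : Measurable[generated U S] (U i) :=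
  Measurable.mono (comap_measurable (U i))
    (le_biSup (fun i => MeasurableSpace.comap (U i) inferInstance) hi) le_rfl

lemma generated_le [mΩ : MeasurableSpace Ω] (hU : ∀ i, Measurable (U i)) :
    generated U S ≤ mΩ :=
  iSup₂_le fun i _ => (hU i).comap_le

lemma indep_generated [mΩ : MeasurableSpace Ω] {P : Measure Ω} (hU : ∀ i, Measurable (U i))
    (hind : iIndepFun U P) (h : Disjoint S T) : Indep (generated U S) (generated U T) P :=
  indep_iSup_of_disjoint (fun i => (hU i).comap_le) hind h

lemma indepFun_of_indep {E F : Type*} [MeasurableSpace E] [MeasurableSpace F]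
    {m₁ m₂ mΩ : MeasurableSpace Ω} {P : Measure Ω} (h : Indep m₁ m₂ P) {V : Ω → E} {Y : Ω → F}
    (hV : Measurable[m₁] V) (hY : Measurable[m₂] Y) : IndepFun V Y P :=
  indep_of_indep_of_le_left (indep_of_indep_of_le_right h hY.comap_le) hV.comap_le

/-- Fubini's theorem for a function of two independent variables. -/
lemma integral_comp_of_indepFun {E F G : Type*} [MeasurableSpace E] [MeasurableSpace F]
    [NormedAddCommGroup G] [NormedSpace ℝ G]
    [mΩ : MeasurableSpace Ω] {P : Measure Ω} [IsProbabilityMeasure P]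
    {V : Ω → E} {Y : Ω → F} (hV : Measurable V) (hY : Measurable Y) (h : IndepFun V Y P)
    {f : E × F → G} (hf : StronglyMeasurable f) (hfi : Integrable (fun ω => f (V ω, Y ω)) P) :
    ∫ ω, f (V ω, Y ω) ∂P = ∫ ω, ∫ y, f (V ω, y) ∂(P.map Y) ∂P := by
  have h1 := (indepFun_iff_map_prod_eq_prod_map_map hV.aemeasurable hY.aemeasurable).1 h
  have := Measure.isProbabilityMeasure_map (μ := P) hV.aemeasurable
  have := Measure.isProbabilityMeasure_map (μ := P) hY.aemeasurable
  have h2 : ∫ ω, f (V ω, Y ω) ∂P = ∫ z, f z ∂(P.map fun ω => (V ω, Y ω)) :=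
    (integral_map (hV.prodMk hY).aemeasurable hf.aestronglyMeasurable).symm
  have h3 : Integrable f (P.map fun ω => (V ω, Y ω)) :=
    (integrable_map_measure hf.aestronglyMeasurable (hV.prodMk hY).aemeasurable).2 hfi
  rw [h2, h1, integral_prod f (h1 ▸ h3)]
  exact integral_map hV.aemeasurable
    (StronglyMeasurable.integral_prod_right (f := fun x y => f (x, y))
      (ν := P.map Y) hf).aestronglyMeasurable

/-- Conditionally on a σ-algebra independent of the uniform variable `Y`, the event `Y ≤ p` has
probability `p`. -/
lemma integral_mul_ite_le {m m' mΩ : MeasurableSpace Ω} {P : Measure Ω} [IsProbabilityMeasure P]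
    (hm : m ≤ mΩ) (hm' : m' ≤ mΩ) (h : Indep m m' P) {Y : Ω → ℝ}
    (hYm : Measurable[m'] Y) (hY : HasLaw Y (volume.restrict (Set.Icc (0 : ℝ) 1)) P)
    {p : Ω → ℝ} (hp : Measurable[m] p) (hp01 : ∀ ω, p ω ∈ Set.Icc (0 : ℝ) 1)
    {A : Ω → ℂ} (hA : Measurable[m] A) {C : ℝ} (hC : ∀ ω, ‖A ω‖ ≤ C) :
    ∫ ω, A ω * (if Y ω ≤ p ω then 1 else 0) ∂P = ∫ ω, A ω * p ω ∂P := by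
  have hY' : Measurable Y := hYm.mono hm' le_rfl
  have hp' : Measurable p := hp.mono hm le_rfl
  have hA' : Measurable A := hA.mono hm le_rfl
  have hV : Measurable[m] (fun ω => (A ω, p ω)) := hA.prodMk hp
  have hf : Measurable (fun z : (ℂ × ℝ) × ℝ => z.1.1 * (if z.2 ≤ z.1.2 then (1 : ℂ) else 0)) :=
    (measurable_fst.comp measurable_fst).mul
      (Measurable.ite (measurableSet_le measurable_snd (measurable_snd.comp measurable_fst))
        measurable_const measurable_const)
  have hint : Integrable (fun ω => A ω * (if Y ω ≤ p ω then (1 : ℂ) else 0)) P := by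
    refine Integrable.of_bound (C := C) ?_ (.of_forall fun ω => ?_)
    · exact (hf.comp ((hA'.prodMk hp').prodMk hY')).aestronglyMeasurable
    · have := hC ω
      have := (norm_nonneg _).trans this
      split_ifs <;> simpa
  have h1 := integral_comp_of_indepFun (hV.mono hm le_rfl) hY' (indepFun_of_indep h hV hYm)
    hf.stronglyMeasurable hint
  simp only at h1
  rw [h1, hY.map_eq]
  refine integral_congr_ae (.of_forall fun ω => ?_)
  simp only
  rw [integral_const_mul]
  congr 1
  have h2 : (fun y : ℝ => if y ≤ p ω then (1 : ℂ) else 0)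
      = (Set.Iic (p ω)).indicator (fun _ => (1 : ℂ)) := by
    ext y; simp [Set.indicator_apply]
  rw [h2, integral_indicator measurableSet_Iic, Measure.restrict_restrict measurableSet_Iic,
    integral_const]
  have h3 : Set.Iic (p ω) ∩ Set.Icc (0 : ℝ) 1 = Set.Icc 0 (p ω) := by
    ext y; simp only [Set.mem_inter_iff, Set.mem_Iic, Set.mem_Icc]
    have := (hp01 ω).2
    constructor
    · rintro ⟨h1, h2, -⟩; exact ⟨h2, h1⟩
    · rintro ⟨h1, h2⟩; exact ⟨h2, h1, h2.trans this⟩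
  simp [h3, (hp01 ω).1]

end Independence

/-! ### Taylor estimates for Bernoulli characteristic functions. -/

section Estimates

lemma norm_prod_le_one {ι : Type*} (s : Finset ι) (x : ι → ℂ) (hx : ∀ i ∈ s, ‖x i‖ ≤ 1) :
    ‖∏ i ∈ s, x i‖ ≤ 1 := by
  rw [norm_prod]
  exact Finset.prod_le_one (fun _ _ => norm_nonneg _) hx

/-- Exchange one factor at a time; the other factors have norm at most one. This reduces the
Gaussian approximation of a sum to that of each summand. -/
lemma norm_prod_sub_prod_le {ι : Type*} (s : Finset ι) (x y : ι → ℂ)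
    (hx : ∀ i ∈ s, ‖x i‖ ≤ 1) (hy : ∀ i ∈ s, ‖y i‖ ≤ 1) :
    ‖∏ i ∈ s, x i - ∏ i ∈ s, y i‖ ≤ ∑ i ∈ s, ‖x i - y i‖ := by
  classical
  induction s using Finset.induction_on with
  | empty => simp
  | insert j s hj ih =>
    rw [Finset.prod_insert hj, Finset.prod_insert hj, Finset.sum_insert hj]
    have hs := ih (fun i hi => hx i (Finset.mem_insert_of_mem hi))
      (fun i hi => hy i (Finset.mem_insert_of_mem hi))
    have h1 : ‖∏ i ∈ s, y i‖ ≤ 1 :=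
      norm_prod_le_one s y fun i hi => hy i (Finset.mem_insert_of_mem hi)
    have h2 := hx j (Finset.mem_insert_self _ _)
    calc ‖x j * ∏ i ∈ s, x i - y j * ∏ i ∈ s, y i‖
        = ‖(x j - y j) * ∏ i ∈ s, y i + x j * (∏ i ∈ s, x i - ∏ i ∈ s, y i)‖ := by ring_nf
      _ ≤ ‖x j - y j‖ * ‖∏ i ∈ s, y i‖ + ‖x j‖ * ‖∏ i ∈ s, x i - ∏ i ∈ s, y i‖ := by
          grw [norm_add_le, norm_mul, norm_mul]
      _ ≤ ‖x j - y j‖ * 1 + 1 * ‖∏ i ∈ s, x i - ∏ i ∈ s, y i‖ := by gcongr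
      _ ≤ _ := by linarith

/-- The characteristic function of a centred Bernoulli variable of parameter `p`. -/
noncomputable def bernoulliCharFun (p θ : ℝ) : ℂ :=
  Complex.exp (-(θ * p) * Complex.I) * (1 + (Complex.exp (θ * Complex.I) - 1) * p)

/-- The definition is the form that conditioning produces; this one is the mean over the two values
`-p` and `1 - p`, suited to norm bounds and Taylor expansion. -/
lemma bernoulliCharFun_eq (p θ : ℝ) :
    bernoulliCharFun p θ = (1 - p) * Complex.exp (((-(θ * p) : ℝ) : ℂ) * Complex.I)
      + p * Complex.exp (((θ * (1 - p) : ℝ) : ℂ) * Complex.I) := by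
  have : Complex.exp (((θ * (1 - p) : ℝ) : ℂ) * Complex.I)
      = Complex.exp (-(θ * p) * Complex.I) * Complex.exp (θ * Complex.I) := by
    rw [← Complex.exp_add]; push_cast; ring_nf
  rw [this, bernoulliCharFun]
  push_cast
  ring

lemma norm_bernoulliCharFun_le {p : ℝ} (hp : p ∈ Set.Icc (0 : ℝ) 1) (θ : ℝ) :
    ‖bernoulliCharFun p θ‖ ≤ 1 := by
  rw [bernoulliCharFun_eq]
  grw [norm_add_le, norm_mul, norm_mul, Complex.norm_exp_ofReal_mul_I,
    Complex.norm_exp_ofReal_mul_I]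
  have h1 : ‖(1 - p : ℂ)‖ = 1 - p := by
    rw [← Complex.ofReal_one, ← Complex.ofReal_sub, Complex.norm_real, Real.norm_of_nonneg]
    linarith [hp.2]
  have h2 : ‖(p : ℂ)‖ = p := by rw [Complex.norm_real, Real.norm_of_nonneg hp.1]
  rw [h1, h2]; linarith

lemma norm_exp_mul_I_sub_le {x θ : ℝ} (hx : |x| ≤ θ) (hθ : θ ≤ 1) :
    ‖Complex.exp (x * Complex.I) - (1 + x * Complex.I - x ^ 2 / 2)‖ ≤ 3 * θ ^ 3 := by
  have h := Complex.norm_exp_sub_sum_le_norm_mul_exp (x * Complex.I) 3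
  have hn : ‖(x * Complex.I : ℂ)‖ = |x| := by simp
  rw [hn] at h
  have h1 : ∑ k ∈ Finset.range 3, (x * Complex.I : ℂ) ^ k / k.factorial
      = 1 + x * Complex.I - x ^ 2 / 2 := by
    simp [Finset.sum_range_succ, mul_pow, Nat.factorial]; ring
  rw [h1] at h
  refine h.trans ?_
  -- The constant `3` of the statement is a bound for `e`.
  have h2 : Real.exp |x| ≤ 3 :=
    (Real.exp_le_exp.2 (hx.trans hθ)).trans (Real.exp_one_lt_d9.le.trans (by norm_num))
  have h3 : |x| ^ 3 ≤ θ ^ 3 := pow_le_pow_left₀ (abs_nonneg _) hx 3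
  nlinarith [abs_nonneg x, pow_nonneg (abs_nonneg x) 3, Real.exp_pos |x|]

/-- Both sides agree to second order in `θ`, the Bernoulli variable being centred with variance `p
(1 - p)`. A cubic error suffices: there will be `N` factors with `θ` of order `N^(-1/2)`. -/
lemma norm_bernoulliCharFun_sub_le {p : ℝ} (hp : p ∈ Set.Icc (0 : ℝ) 1) {θ : ℝ}
    (hθ : |θ| ≤ 1) :
    ‖bernoulliCharFun p θ - (Real.exp (-(θ ^ 2 / 2 * (p * (1 - p)))) : ℝ)‖ ≤ 6 * |θ| ^ 3 := by
  obtain ⟨hp0, hp1⟩ := hp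
  have hθ0 := abs_nonneg θ
  have h1 : ‖Complex.exp (((-(θ * p) : ℝ) : ℂ) * Complex.I)
      - (1 + ((-(θ * p) : ℝ) : ℂ) * Complex.I - ((-(θ * p) : ℝ) : ℂ) ^ 2 / 2)‖ ≤ 3 * |θ| ^ 3 := by
    refine norm_exp_mul_I_sub_le ?_ hθ
    rw [abs_neg, abs_mul, abs_of_nonneg hp0]
    nlinarith
  have h2 : ‖Complex.exp (((θ * (1 - p) : ℝ) : ℂ) * Complex.I)
      - (1 + ((θ * (1 - p) : ℝ) : ℂ) * Complex.I - ((θ * (1 - p) : ℝ) : ℂ) ^ 2 / 2)‖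
      ≤ 3 * |θ| ^ 3 := by
    refine norm_exp_mul_I_sub_le ?_ hθ
    rw [abs_mul, abs_of_nonneg (sub_nonneg.2 hp1)]
    nlinarith
  set u : ℝ := θ ^ 2 / 2 * (p * (1 - p)) with hu
  have hpp : 0 ≤ p * (1 - p) := mul_nonneg hp0 (sub_nonneg.2 hp1)
  have hpp' : p * (1 - p) ≤ 1 := by nlinarith
  have hθ2 : θ ^ 2 = |θ| ^ 2 := (sq_abs θ).symm
  have hu0 : 0 ≤ u := by positivity
  have hu1 : u ≤ |θ| ^ 2 := by rw [hu, hθ2]; nlinarith [sq_nonneg |θ|]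
  have hu2 : u ≤ 1 := hu1.trans (pow_le_one₀ hθ0 hθ)
  have h3 : |Real.exp (-u) - (1 - u)| ≤ |θ| ^ 3 := by
    have := Real.abs_exp_sub_one_sub_id_le (x := -u) (by rw [abs_neg, abs_of_nonneg hu0]; exact hu2)
    calc |Real.exp (-u) - (1 - u)| = |Real.exp (-u) - 1 - -u| := by ring_nf
      _ ≤ (-u) ^ 2 := this
      _ = u ^ 2 := by ring
      _ ≤ (|θ| ^ 2) ^ 2 := pow_le_pow_left₀ hu0 hu1 2
      _ = |θ| ^ 3 * |θ| := by ring
      _ ≤ |θ| ^ 3 := mul_le_of_le_one_right (by positivity) hθ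
  rw [bernoulliCharFun_eq]
  set e₁ := Complex.exp (((-(θ * p) : ℝ) : ℂ) * Complex.I)
  set e₂ := Complex.exp (((θ * (1 - p) : ℝ) : ℂ) * Complex.I)
  have hn1 : ‖(1 - p : ℂ)‖ = 1 - p := by
    rw [← Complex.ofReal_one, ← Complex.ofReal_sub, Complex.norm_real, Real.norm_of_nonneg]
    linarith
  have hn2 : ‖(p : ℂ)‖ = p := by rw [Complex.norm_real, Real.norm_of_nonneg hp0]
  have h3' : ‖((Real.exp (-u) - (1 - u) : ℝ) : ℂ)‖ ≤ |θ| ^ 3 := by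
    rw [Complex.norm_real]; exact h3
  calc ‖(1 - p) * e₁ + p * e₂ - (Real.exp (-u) : ℝ)‖
      = ‖(1 - p) * (e₁ - (1 + ((-(θ * p) : ℝ) : ℂ) * Complex.I - ((-(θ * p) : ℝ) : ℂ) ^ 2 / 2))
        + p * (e₂ - (1 + ((θ * (1 - p) : ℝ) : ℂ) * Complex.I - ((θ * (1 - p) : ℝ) : ℂ) ^ 2 / 2))
        - ((Real.exp (-u) - (1 - u) : ℝ) : ℂ)‖ := by
        congr 1
        -- The first-order terms cancel, and `(1 - p) p^2 + p (1 - p)^2 = p (1 - p)`.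
        rw [hu]; push_cast; ring
    _ ≤ (1 - p) * (3 * |θ| ^ 3) + p * (3 * |θ| ^ 3) + |θ| ^ 3 := by
        refine (norm_sub_le _ _).trans (add_le_add ((norm_add_le _ _).trans (add_le_add ?_ ?_)) h3')
        · rw [norm_mul, hn1]
          exact mul_le_mul_of_nonneg_left h1 (by linarith)
        · rw [norm_mul, hn2]
          exact mul_le_mul_of_nonneg_left h2 (by linarith)
    _ ≤ 6 * |θ| ^ 3 := by nlinarith [pow_nonneg hθ0 3]

lemma abs_exp_neg_sub_exp_neg_le {x y : ℝ} (hx : 0 ≤ x) (hy : 0 ≤ y) :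
    |Real.exp (-x) - Real.exp (-y)| ≤ |x - y| := by
  wlog h : x ≤ y generalizing x y
  · rw [abs_sub_comm, abs_sub_comm x]; exact this hy hx (le_of_not_ge h)
  rw [abs_of_nonneg (by simpa using h), abs_of_nonpos (by linarith)]
  have h1 : Real.exp (-y) = Real.exp (-x) * Real.exp (-(y - x)) := by
    rw [← Real.exp_add]; ring_nf
  have h2 : Real.exp (-x) ≤ 1 := by simpa using hx
  have h3 := Real.one_sub_le_exp_neg (y - x)
  have h4 : Real.exp (-(y - x)) ≤ 1 := by simpa using h
  nlinarith [Real.exp_pos (-x)]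

end Estimates

/-! ### Weak convergence on sequence space from finite-dimensional distributions. -/

section FiniteDimensionalDistributions

/-- The first `k` coordinates of a sequence, as a point of a Euclidean space. -/
def truncate (k : ℕ) (x : ℕ → ℝ) : EuclideanSpace ℝ (Fin k) :=
  WithLp.toLp 2 fun i => x i

lemma continuous_truncate (k : ℕ) : Continuous (truncate k) :=
  (PiLp.continuous_toLp 2 _).comp (continuous_pi fun i => continuous_apply (i : ℕ))

/-- The union of the open sets depending on the first `k` coordinates only that are contained
in `G`. -/
def cylinderInterior (G : Set (ℕ → ℝ)) (k : ℕ) : Set (EuclideanSpace ℝ (Fin k)) :=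
  ⋃₀ {O | IsOpen O ∧ truncate k ⁻¹' O ⊆ G}

lemma isOpen_cylinderInterior (G : Set (ℕ → ℝ)) (k : ℕ) : IsOpen (cylinderInterior G k) :=
  isOpen_sUnion fun _ h => h.1

lemma preimage_cylinderInterior_subset (G : Set (ℕ → ℝ)) (k : ℕ) :
    truncate k ⁻¹' cylinderInterior G k ⊆ G := by
  rintro x ⟨O, ⟨-, hO⟩, hx⟩
  exact hO hx

lemma monotone_preimage_cylinderInterior (G : Set (ℕ → ℝ)) :
    Monotone fun k => truncate k ⁻¹' cylinderInterior G k := by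
  rintro k l hkl x ⟨O, ⟨hO, hOG⟩, hx⟩
  let ρ : EuclideanSpace ℝ (Fin l) → EuclideanSpace ℝ (Fin k) :=
    fun y => WithLp.toLp 2 fun i => y (Fin.castLE hkl i)
  have hρ : Continuous ρ := by
    refine (PiLp.continuous_toLp 2 _).comp (continuous_pi fun i => ?_)
    exact (continuous_apply (Fin.castLE hkl i)).comp (PiLp.continuous_ofLp 2 _)
  exact ⟨ρ ⁻¹' O, ⟨hO.preimage hρ, hOG⟩, hx⟩

/-- A basic neighbourhood in the product topology constrains finitely many coordinates, all of them
below some `k`. -/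
lemma iUnion_preimage_cylinderInterior {G : Set (ℕ → ℝ)} (hG : IsOpen G) :
    ⋃ k, truncate k ⁻¹' cylinderInterior G k = G := by
  refine Set.Subset.antisymm (Set.iUnion_subset (preimage_cylinderInterior_subset G)) fun x hx => ?_
  obtain ⟨I, u, hu, hIu⟩ := isOpen_pi_iff.1 hG x hx
  obtain ⟨k, hk⟩ : ∃ k, ∀ i ∈ I, i < k :=
    ⟨I.sup id + 1, fun i hi => Nat.lt_succ_of_le (Finset.le_sup (f := id) hi)⟩
  refine Set.mem_iUnion.2 ⟨k, ⋂ i ∈ I.attach, (fun y => y ⟨i, hk i i.2⟩) ⁻¹' u i, ⟨?_, ?_⟩, ?_⟩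
  · refine isOpen_biInter_finset fun i _ => (hu i i.2).1.preimage ?_
    exact (continuous_apply (⟨i, hk i i.2⟩ : Fin k)).comp (PiLp.continuous_ofLp 2 _)
  · intro y hy
    refine hIu fun i hi => ?_
    have := Set.mem_iInter₂.1 hy ⟨i, hi⟩ (Finset.mem_attach _ _)
    simpa [truncate] using this
  · refine Set.mem_iInter₂.2 fun i _ => ?_
    simpa [truncate] using (hu i i.2).2

lemma measurable_truncate_comp {Ω : Type*} [MeasurableSpace Ω] {Y : Ω → ℕ → ℝ}
    (hY : Measurable Y) (k : ℕ) : Measurable fun ω => truncate k (Y ω) :=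
  (continuous_truncate k).measurable.comp hY

lemma charFun_map_truncate {Ω : Type*} [MeasurableSpace Ω] {P : Measure Ω} {Y : Ω → ℕ → ℝ}
    (hY : Measurable Y) {k : ℕ} (v : EuclideanSpace ℝ (Fin k)) :
    charFun (P.map fun ω => truncate k (Y ω)) v
      = ∫ ω, Complex.exp ((∑ i ∈ Finset.range k,
          (if hi : i < k then v ⟨i, hi⟩ else 0) * Y ω i : ℝ) * Complex.I) ∂P := by
  rw [charFun_apply, integral_map (measurable_truncate_comp hY k).aemeasurable (by fun_prop)]
  refine integral_congr_ae (.of_forall fun ω => ?_)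
  simp only [PiLp.inner_apply, truncate, Finset.sum_range]
  simp

/-- Convergence of the characteristic functions of the finite-dimensional distributions implies
convergence in distribution of random sequences. -/
theorem tendstoInDistribution_of_tendsto_charFun {Ω Ω' : Type*} [MeasurableSpace Ω]
    [MeasurableSpace Ω'] {P : Measure Ω} {P' : Measure Ω'} [IsProbabilityMeasure P]
    [IsProbabilityMeasure P'] {X : ℕ → Ω → ℕ → ℝ} {Z : Ω' → ℕ → ℝ}
    (hX : ∀ n, Measurable (X n)) (hZ : Measurable Z)
    (h : ∀ (ξ : ℕ → ℝ) (k : ℕ), Tendsto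
      (fun n => ∫ ω, Complex.exp ((∑ i ∈ Finset.range k, ξ i * X n ω i : ℝ) * Complex.I) ∂P) atTop
      (𝓝 (∫ ω, Complex.exp ((∑ i ∈ Finset.range k, ξ i * Z ω i : ℝ) * Complex.I) ∂P'))) :
    TendstoInDistribution X atTop Z (fun _ => P) P' := by
  refine ⟨fun n => (hX n).aemeasurable, hZ.aemeasurable, ?_⟩
  -- Portmanteau: the lower bound on open sets is passed from finite dimensions to `G` by continuity
  -- from below along its cylinder interiors.
  refine tendsto_of_forall_isOpen_le_liminf_nat' fun G hG => ?_
  have hfin : ∀ k, TendstoInDistribution (fun n ω => truncate k (X n ω)) atTop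
      (fun ω => truncate k (Z ω)) (fun _ => P) P' := by
    intro k
    refine ⟨fun n => (measurable_truncate_comp (hX n) k).aemeasurable,
      (measurable_truncate_comp hZ k).aemeasurable, ?_⟩
    refine ProbabilityMeasure.tendsto_of_tendsto_charFun fun v => ?_
    have h1 := h (fun i => if hi : i < k then v ⟨i, hi⟩ else 0) k
    rw [← charFun_map_truncate hZ v] at h1
    exact h1.congr fun n => (charFun_map_truncate (hX n) v).symm
  have hle : ∀ k, (P'.map Z) (truncate k ⁻¹' cylinderInterior G k)
      ≤ liminf (fun n => (P.map (X n)) G) atTop := by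
    intro k
    have ho := isOpen_cylinderInterior G k
    have ht := (continuous_truncate k).measurable
    have h1 := ProbabilityMeasure.le_liminf_measure_open_of_tendsto (hfin k).tendsto ho
    simp only [ProbabilityMeasure.coe_mk] at h1
    rw [Measure.map_apply hZ (ht ho.measurableSet)]
    rw [Measure.map_apply (measurable_truncate_comp hZ k) ho.measurableSet] at h1
    refine h1.trans (liminf_le_liminf (.of_forall fun n => ?_))
    rw [Measure.map_apply (measurable_truncate_comp (hX n) k) ho.measurableSet,
      Measure.map_apply (hX n) hG.measurableSet]
    exact measure_mono fun ω hω => preimage_cylinderInterior_subset G k hω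
  simp only [ProbabilityMeasure.coe_mk]
  conv_lhs => rw [← iUnion_preimage_cylinderInterior hG]
  rw [(monotone_preimage_cylinderInterior G).measure_iUnion]
  exact iSup_le hle

end FiniteDimensionalDistributions

/-! ### The limit process: Gaussian and Markov properties, nonnegative variances. -/

section LimitProcess

variable {Ω : Type*} {a b : ℕ} {α : ℝ} {B : ℕ → Ω → ℝ}

lemma limitProcess_eq_sum (t : ℕ) (ω : Ω) :
    limitProcess a b α B t ω = ∑ k ∈ Finset.range t, √(sigmaSq a b α k) * B (k + 1) ω := by
  induction t with
  | zero => simp [limitProcess]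
  | succ t ih => rw [limitProcess, ih, Finset.sum_range_succ]

/-- The index `k` stands for `B (k + 1)`, so `k < n` selects `B 1, …, B n`. -/
lemma measurable_generated_limitProcess {t n : ℕ} (h : t ≤ n) :
    Measurable[generated (fun k => B (k + 1)) {k | k < n}] (limitProcess a b α B t) := by
  rw [funext (limitProcess_eq_sum (a := a) (b := b) (α := α) (B := B) t)]
  refine Finset.measurable_fun_sum _ fun k hk => Measurable.const_mul ?_ _
  exact measurable_generated (U := fun k => B (k + 1))
    (show k < n from (Finset.mem_range.1 hk).trans_le h)

/-- Finitely many values of the process are a linear image `L` of the Gaussian vector `(B 1, …, B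
n)`. -/
lemma isGaussianProcess_limitProcess [MeasurableSpace Ω] {P : Measure Ω}
    (hB_indep : iIndepFun (fun t : ℕ => B (t + 1)) P)
    (hB_law : ∀ t, 1 ≤ t → HasLaw (B t) (gaussianReal 0 1) P) :
    IsGaussianProcess (limitProcess a b α B) P := by
  refine ⟨fun I => ?_⟩
  obtain ⟨n, hn⟩ : ∃ n, ∀ i ∈ I, i ≤ n := ⟨I.sup id, fun i hi => Finset.le_sup (f := id) hi⟩
  have hG : HasGaussianLaw (fun ω (k : Fin n) => B (k + 1) ω) P :=
    iIndepFun.hasGaussianLaw (X := fun (k : Fin n) => B (k + 1))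
      (fun k => (hB_law _ (by omega)).hasGaussianLaw)
      (hB_indep.precomp Fin.val_injective)
  let L : (Fin n → ℝ) →L[ℝ] (I → ℝ) := ContinuousLinearMap.pi fun i =>
    ∑ k : Fin n, if (k : ℕ) < i then √(sigmaSq a b α k) • ContinuousLinearMap.proj k else 0
  refine (hG.map_fun L).congr (.of_forall fun ω => ?_)
  ext i
  simp only [L, ContinuousLinearMap.coe_pi', Finset.restrict, limitProcess_eq_sum]
  have h1 : ∀ k : Fin n, ((if (k : ℕ) < i then √(sigmaSq a b α k) • ContinuousLinearMap.proj k
      else 0 : (Fin n → ℝ) →L[ℝ] ℝ)) (fun k : Fin n => B (k + 1) ω)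
      = if (k : ℕ) < i then √(sigmaSq a b α k) * B (k + 1) ω else 0 := by
    intro k; split_ifs <;> simp
  rw [sum_apply, Finset.sum_congr rfl fun k _ => h1 k,
    ← Finset.sum_range (fun k => if k < (i : ℕ) then √(sigmaSq a b α k) * B (k + 1) ω else 0),
    ← Finset.sum_filter]
  refine Finset.sum_congr ?_ fun _ _ => rfl
  ext k
  have := hn i i.2
  simp only [Finset.mem_filter, Finset.mem_range]
  omega

/-- If `D` is independent of the σ-algebra `m`, then the conditional law of `V + D` given `m`, for
an `m`-measurable `V`, is a function of `V`. -/
lemma condExp_indicator_add_of_indep {m m' : MeasurableSpace Ω} {mΩ : MeasurableSpace Ω}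
    {P : Measure Ω} [IsProbabilityMeasure P]
    (hm : m ≤ mΩ) (hm' : m' ≤ mΩ) (h : Indep m m' P) {V D : Ω → ℝ}
    (hV : Measurable[m] V) (hD : Measurable[m'] D) {A : Set ℝ} (hA : MeasurableSet A) :
    (fun ω => ∫ y, A.indicator (fun _ => (1 : ℝ)) (V ω + y) ∂(P.map D))
      =ᵐ[P] P[((fun ω => V ω + D ω) ⁻¹' A).indicator (fun _ => (1 : ℝ)) | m] := by
  have hV' : Measurable V := hV.mono hm le_rfl
  have hD' : Measurable D := hD.mono hm' le_rfl
  have := Measure.isProbabilityMeasure_map (μ := P) hD'.aemeasurable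
  have hf0 : Measurable (fun z : ℝ × ℝ => A.indicator (fun _ => (1 : ℝ)) (z.1 + z.2)) :=
    (measurable_const.indicator hA).comp (measurable_fst.add measurable_snd)
  have hg : Measurable fun v => ∫ y, A.indicator (fun _ => (1 : ℝ)) (v + y) ∂(P.map D) :=
    (StronglyMeasurable.integral_prod_right (f := fun x y => A.indicator (fun _ => (1 : ℝ)) (x + y))
      (ν := P.map D) hf0.stronglyMeasurable).measurable
  have hgi : Integrable
      (fun ω => ∫ y, A.indicator (fun _ => (1 : ℝ)) (V ω + y) ∂(P.map D)) P := by
    refine Integrable.of_bound (C := 1) (hg.comp hV').aestronglyMeasurable (.of_forall fun ω => ?_)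
    refine (norm_integral_le_of_norm_le_const (C := 1) (.of_forall fun y => ?_)).trans (by simp)
    by_cases hy : V ω + y ∈ A <;> simp [hy]
  refine ae_eq_condExp_of_forall_setIntegral_eq hm ?_ (fun _ _ _ => hgi.integrableOn) ?_
    (hg.comp hV).aestronglyMeasurable
  · exact (integrable_const 1).indicator ((hV'.add hD') hA)
  · intro s hs _
    -- The indicator of `s` is carried as a coordinate beside `V`, so that Fubini for the
    -- independent pair `(W, D)` gives the integral over `s`.
    let W : Ω → ℝ × ℝ := fun ω => (s.indicator (fun _ => (1 : ℝ)) ω, V ω)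
    have hW : Measurable[m] W := (Measurable.indicator measurable_const hs).prodMk hV
    let f : (ℝ × ℝ) × ℝ → ℝ := fun z => z.1.1 * A.indicator (fun _ => (1 : ℝ)) (z.1.2 + z.2)
    have hf : Measurable f := (measurable_fst.comp measurable_fst).mul
      (hf0.comp ((measurable_snd.comp measurable_fst).prodMk measurable_snd))
    have hfi : Integrable (fun ω => f (W ω, D ω)) P := by
      refine Integrable.of_bound (C := 1)
        (hf.comp ((hW.mono hm le_rfl).prodMk hD')).aestronglyMeasurable (.of_forall fun ω => ?_)
      by_cases h1 : ω ∈ s <;> by_cases h2 : V ω + D ω ∈ A <;> simp [f, W, h1, h2]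
    have key := integral_comp_of_indepFun (hW.mono hm le_rfl) hD' (indepFun_of_indep h hW hD)
      hf.stronglyMeasurable hfi
    rw [← integral_indicator (hm _ hs), ← integral_indicator (hm _ hs)]
    have e1 : (s.indicator fun ω => ∫ y, A.indicator (fun _ => (1 : ℝ)) (V ω + y) ∂(P.map D))
        = fun ω => ∫ y, f (W ω, y) ∂(P.map D) := by
      ext ω
      by_cases h1 : ω ∈ s <;> simp [f, W, h1]
    have e2 : (s.indicator (((fun ω => V ω + D ω) ⁻¹' A).indicator (fun _ => (1 : ℝ))))
        = fun ω => f (W ω, D ω) := by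
      ext ω
      by_cases h1 : ω ∈ s <;> by_cases h2 : V ω + D ω ∈ A <;> simp [f, W, h1, h2]
    rw [e1, e2, key]

/-- The increment `D` from `s` to `t` is independent of `B 1, …, B s`. Conditioning on the whole
history or on `W s` alone therefore gives the same function of `W s`. -/
lemma isMarkovProcess_limitProcess [mΩ : MeasurableSpace Ω] {P : Measure Ω}
    [IsProbabilityMeasure P] (hB_meas : ∀ t, 1 ≤ t → Measurable (B t))
    (hB_indep : iIndepFun (fun t : ℕ => B (t + 1)) P) :
    IsMarkovProcess (limitProcess a b α B) P := by
  have hB : ∀ k, Measurable (B (k + 1)) := fun k => hB_meas _ (by omega)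
  have hmeas : ∀ t, Measurable (limitProcess a b α B t) := fun t =>
    (measurable_generated_limitProcess le_rfl).mono (generated_le hB) le_rfl
  refine ⟨hmeas, fun s t hst A hA => ?_⟩
  set W := limitProcess a b α B
  let D : Ω → ℝ := fun ω => ∑ k ∈ Finset.Ico s t, √(sigmaSq a b α k) * B (k + 1) ω
  have hWt : W t = fun ω => W s ω + D ω := by
    ext ω
    simp only [W, D, limitProcess_eq_sum]
    rw [Finset.sum_range_add_sum_Ico _ hst]
  have hD : Measurable[generated (fun k => B (k + 1)) {k | s ≤ k}] D := by
    refine Finset.measurable_fun_sum _ fun k hk => Measurable.const_mul ?_ _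
    exact measurable_generated (U := fun k => B (k + 1))
      (show s ≤ k from (Finset.mem_Ico.1 hk).1)
  have hind : Indep (generated (fun k => B (k + 1)) {k | k < s})
      (generated (fun k => B (k + 1)) {k | s ≤ k}) P :=
    indep_generated hB hB_indep (Set.disjoint_left.2 fun k (hk : k < s) (hk' : s ≤ k) =>
      not_le.2 hk hk')
  have hle1 : (⨆ r ∈ Set.Iic s, MeasurableSpace.comap (W r) inferInstance)
      ≤ generated (fun k => B (k + 1)) {k | k < s} :=
    iSup₂_le fun r hr => (measurable_generated_limitProcess hr).comap_le
  have hle2 : MeasurableSpace.comap (W s) inferInstance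
      ≤ ⨆ r ∈ Set.Iic s, MeasurableSpace.comap (W r) inferInstance :=
    le_biSup (fun r => MeasurableSpace.comap (W r) inferInstance) (Set.mem_Iic.2 le_rfl)
  have hV2 : Measurable[MeasurableSpace.comap (W s) inferInstance] (W s) := comap_measurable _
  have hgen : generated (fun k => B (k + 1)) {k | k < s} ≤ mΩ := generated_le hB
  have h1 := condExp_indicator_add_of_indep (hle1.trans hgen) (generated_le hB)
    (indep_of_indep_of_le_left hind hle1) (hV2.mono hle2 le_rfl) hD hA
  have h2 := condExp_indicator_add_of_indep ((hle2.trans hle1).trans hgen) (generated_le hB)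
    (indep_of_indep_of_le_left hind (hle2.trans hle1)) hV2 hD hA
  rw [hWt]
  exact h1.symm.trans h2

/-- The recursion in time for the characteristic functions of the finite-dimensional distributions
of the limit process. -/
lemma integral_exp_limitProcess_succ [MeasurableSpace Ω] {P : Measure Ω}
    (hB_meas : ∀ t, 1 ≤ t → Measurable (B t))
    (hB_indep : iIndepFun (fun t : ℕ => B (t + 1)) P)
    (hB_law : ∀ t, 1 ≤ t → HasLaw (B t) (gaussianReal 0 1) P) {t : ℕ}
    (hσ : 0 ≤ sigmaSq a b α t) {A : Ω → ℂ}
    (hA : Measurable[generated (fun k => B (k + 1)) {k | k < t}] A) (x : ℝ) :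
    ∫ ω, A ω * Complex.exp ((x * (limitProcess a b α B (t + 1) ω - limitProcess a b α B t ω) : ℝ)
        * Complex.I) ∂P
      = (∫ ω, A ω ∂P) * (Real.exp (-(x ^ 2 * sigmaSq a b α t / 2)) : ℝ) := by
  have hB : ∀ k, Measurable (B (k + 1)) := fun k => hB_meas _ (by omega)
  have hind : Indep (generated (fun k => B (k + 1)) {k | k < t})
      (generated (fun k => B (k + 1)) {t}) P :=
    indep_generated hB hB_indep (by simp)
  let E : Ω → ℂ := fun ω => Complex.exp ((x * √(sigmaSq a b α t) * B (t + 1) ω) * Complex.I)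
  have hBt : Measurable[generated (fun k => B (k + 1)) {t}] (B (t + 1)) :=
    measurable_generated (U := fun k => B (k + 1)) (Set.mem_singleton t)
  have hEm : Measurable fun y : ℝ => Complex.exp ((x * √(sigmaSq a b α t) * y) * Complex.I) := by
    fun_prop
  have hE : Measurable[generated (fun k => B (k + 1)) {t}] E := hEm.comp hBt
  have h1 : (fun ω => A ω * Complex.exp ((x * (limitProcess a b α B (t + 1) ω
      - limitProcess a b α B t ω) : ℝ) * Complex.I)) = fun ω => A ω * E ω := by
    ext ω
    simp only [limitProcess, E, add_sub_cancel_left]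
    push_cast
    ring_nf
  rw [h1, (indepFun_of_indep hind hA hE).integral_fun_mul_eq_mul_integral
    (hA.mono (generated_le hB) le_rfl).aestronglyMeasurable
    (hE.mono (generated_le hB) le_rfl).aestronglyMeasurable]
  congr 1
  have h2 := charFun_gaussianReal (μ := 0) (v := 1) (x * √(sigmaSq a b α t))
  rw [← (hB_law (t + 1) (by omega)).map_eq, charFun_apply_real,
    integral_map (hB t).aemeasurable (by fun_prop)] at h2
  have h3 : ∫ ω, E ω ∂P = ∫ ω, Complex.exp (((x * √(sigmaSq a b α t) : ℝ) : ℂ)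
      * (B (t + 1) ω : ℂ) * Complex.I) ∂P := by
    simp [E]
  rw [h3, h2]
  push_cast
  congr 1
  -- Nonnegativity is essential here: the real square root of a negative number is `0`.
  have h4 : ((√(sigmaSq a b α t) : ℝ) : ℂ) ^ 2 = (sigmaSq a b α t : ℂ) := by
    rw [← Complex.ofReal_pow, Real.sq_sqrt hσ]
  rw [mul_pow, h4]
  simp

/-- With `y = 1 / (t + a + b + 1)` the recursion reads `x ↦ x (1 - y) (1 + y - 2αy) + y^2 c`. The
factor of `x` lies in `[0, 1 - y^2]`, so `[0, c]` is preserved. -/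
lemma xInf_mem_Icc (ha : 1 ≤ a) (hb : 1 ≤ b) (hα : α ∈ Set.Icc (0 : ℝ) 1) (t : ℕ) :
    xInf a b α t ∈ Set.Icc (0 : ℝ) ((a : ℝ) / ((a : ℝ) + (b : ℝ))
      - (a : ℝ) ^ 2 / ((a : ℝ) + (b : ℝ)) ^ 2) := by
  obtain ⟨hα0, hα1⟩ := hα
  have ha' : (1 : ℝ) ≤ a := by exact_mod_cast ha
  have hb' : (1 : ℝ) ≤ b := by exact_mod_cast hb
  have hc : (0 : ℝ) ≤ (a : ℝ) / ((a : ℝ) + (b : ℝ)) - (a : ℝ) ^ 2 / ((a : ℝ) + (b : ℝ)) ^ 2 := by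
    have : (a : ℝ) / ((a : ℝ) + (b : ℝ)) - (a : ℝ) ^ 2 / ((a : ℝ) + (b : ℝ)) ^ 2
        = a * b / ((a : ℝ) + (b : ℝ)) ^ 2 := by field_simp; ring
    rw [this]; positivity
  set c := (a : ℝ) / ((a : ℝ) + (b : ℝ)) - (a : ℝ) ^ 2 / ((a : ℝ) + (b : ℝ)) ^ 2
  induction t with
  | zero => exact ⟨le_rfl, hc⟩
  | succ t ih =>
    obtain ⟨h0, h1⟩ := ih
    set y := ((t : ℝ) + ((a : ℝ) + (b : ℝ)) + 1)⁻¹ with hy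
    have ht : (0 : ℝ) ≤ t := t.cast_nonneg
    have hy0 : 0 ≤ y := by positivity
    have hy1 : y ≤ 1 := inv_le_one_of_one_le₀ (by linarith)
    have hx : xInf a b α (t + 1)
        = xInf a b α t * ((1 - y) * (1 + y - 2 * α * y)) + y ^ 2 * c := by
      rw [xInf]
      simp only [div_eq_mul_inv, ← inv_pow, ← hy, one_mul]
      simp only [c, div_eq_mul_inv, ← inv_pow]
      ring
    have h2 : 0 ≤ 1 + y - 2 * α * y := by nlinarith
    have h3 : (1 - y) * (1 + y - 2 * α * y) ≤ 1 - y ^ 2 := by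
      nlinarith [mul_nonneg (mul_nonneg hα0 hy0) (sub_nonneg.2 hy1)]
    have h4 : 0 ≤ (1 - y) * (1 + y - 2 * α * y) := mul_nonneg (by linarith) h2
    rw [hx]
    constructor
    · positivity
    · nlinarith [mul_le_mul h1 h3 h4 hc]

lemma sigmaSq_nonneg (ha : 1 ≤ a) (hb : 1 ≤ b) (hα : α ∈ Set.Icc (0 : ℝ) 1) (t : ℕ) :
    0 ≤ sigmaSq a b α t := by
  obtain ⟨h0, h1⟩ := xInf_mem_Icc ha hb hα t
  obtain ⟨hα0, hα1⟩ := hα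
  refine mul_nonneg (by positivity) ?_
  have : (1 - α) ^ 2 ≤ 1 := by nlinarith
  nlinarith

end LimitProcess

/-! ### Conditional mean and characteristic function of one Bernoulli noise. -/

section BernoulliIncrements

/-- The centred Bernoulli variable `1_{Y ≤ p} - p`. -/
noncomputable def bernoulliNoise (y p : ℝ) : ℝ :=
  (if y ≤ p then 1 else 0) - p

lemma measurable_bernoulliNoise : Measurable fun z : ℝ × ℝ => bernoulliNoise z.1 z.2 :=
  (Measurable.ite (measurableSet_le measurable_fst measurable_snd) measurable_const
    measurable_const).sub measurable_snd

lemma abs_bernoulliNoise_le {y p : ℝ} (hp : p ∈ Set.Icc (0 : ℝ) 1) : |bernoulliNoise y p| ≤ 1 := by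
  obtain ⟨h0, h1⟩ := hp
  rw [bernoulliNoise, abs_le]
  split_ifs <;> constructor <;> linarith

/-- The noise takes two values, so its exponential is affine in the indicator and
`integral_mul_ite_le` applies. -/
lemma exp_bernoulliNoise (y p θ : ℝ) :
    Complex.exp ((θ * bernoulliNoise y p : ℝ) * Complex.I)
      = Complex.exp (-(θ * p) * Complex.I)
        + Complex.exp (-(θ * p) * Complex.I) * (Complex.exp (θ * Complex.I) - 1)
          * (if y ≤ p then 1 else 0) := by
  rw [bernoulliNoise]
  split_ifs
  · have h : Complex.exp ((θ * (1 - p) : ℝ) * Complex.I)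
        = Complex.exp (-(θ * p) * Complex.I) * Complex.exp (θ * Complex.I) := by
      rw [← Complex.exp_add]
      push_cast
      ring_nf
    rw [h]
    ring
  · push_cast
    ring_nf

lemma norm_exp_neg_mul_I (θ p : ℝ) : ‖Complex.exp (-(θ * p) * Complex.I)‖ = 1 := by
  have := Complex.norm_exp_ofReal_mul_I (-(θ * p))
  push_cast at this
  exact this

variable {Ω : Type*} {m m' mΩ : MeasurableSpace Ω} {P : Measure Ω} [IsProbabilityMeasure P]
  {Y p : Ω → ℝ}

/-- The indicator has conditional mean `p`, by `integral_mul_ite_le`. This is the source of the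
orthogonality of the noises. -/
lemma integral_mul_bernoulliNoise (hm : m ≤ mΩ) (hm' : m' ≤ mΩ) (h : Indep m m' P)
    (hYm : Measurable[m'] Y) (hY : HasLaw Y (volume.restrict (Set.Icc (0 : ℝ) 1)) P)
    (hp : Measurable[m] p) (hp01 : ∀ ω, p ω ∈ Set.Icc (0 : ℝ) 1)
    {A : Ω → ℝ} (hA : Measurable[m] A) {C : ℝ} (hC : ∀ ω, |A ω| ≤ C) :
    ∫ ω, A ω * bernoulliNoise (Y ω) (p ω) ∂P = 0 := by
  have hA' : Measurable A := hA.mono hm le_rfl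
  have hp' : Measurable p := hp.mono hm le_rfl
  have hY' : Measurable Y := hYm.mono hm' le_rfl
  have hC0 : ∀ ω, 0 ≤ C := fun ω => (abs_nonneg _).trans (hC ω)
  have h1 := integral_mul_ite_le hm hm' h hYm hY hp hp01
    (A := fun ω => (A ω : ℂ)) (Complex.measurable_ofReal.comp hA) (C := C) (by simpa using hC)
  have e1 : (fun ω => (A ω : ℂ) * (if Y ω ≤ p ω then 1 else 0))
      = fun ω => ((A ω * (if Y ω ≤ p ω then 1 else 0) : ℝ) : ℂ) := by
    ext ω; split_ifs <;> simp
  have e2 : (fun ω => (A ω : ℂ) * (p ω : ℂ)) = fun ω => ((A ω * p ω : ℝ) : ℂ) := by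
    ext ω; simp
  rw [e1, e2, integral_complex_ofReal, integral_complex_ofReal, Complex.ofReal_inj] at h1
  simp only [bernoulliNoise, mul_sub]
  rw [integral_sub, h1, sub_self]
  · refine Integrable.of_bound (C := C) (hA'.mul (Measurable.ite (measurableSet_le hY' hp')
      measurable_const measurable_const)).aestronglyMeasurable (.of_forall fun ω => ?_)
    have := hC ω
    have := hC0 ω
    split_ifs <;> simpa
  · refine Integrable.of_bound (C := C) (hA'.mul hp').aestronglyMeasurable (.of_forall fun ω => ?_)
    rw [Real.norm_eq_abs, abs_mul, abs_of_nonneg (hp01 ω).1]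
    exact (mul_le_of_le_one_right (abs_nonneg _) (hp01 ω).2).trans (hC ω)

lemma integral_mul_exp_bernoulliNoise (hm : m ≤ mΩ) (hm' : m' ≤ mΩ) (h : Indep m m' P)
    (hYm : Measurable[m'] Y) (hY : HasLaw Y (volume.restrict (Set.Icc (0 : ℝ) 1)) P)
    (hp : Measurable[m] p) (hp01 : ∀ ω, p ω ∈ Set.Icc (0 : ℝ) 1)
    {A : Ω → ℂ} (hA : Measurable[m] A) (hA1 : ∀ ω, ‖A ω‖ ≤ 1) (θ : ℝ) :
    ∫ ω, A ω * Complex.exp ((θ * bernoulliNoise (Y ω) (p ω) : ℝ) * Complex.I) ∂P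
      = ∫ ω, A ω * bernoulliCharFun (p ω) θ ∂P := by
  have hp' : Measurable p := hp.mono hm le_rfl
  have hY' : Measurable Y := hYm.mono hm' le_rfl
  have hg : Measurable fun x : ℝ => Complex.exp (-(θ * x) * Complex.I) := by fun_prop
  let A₀ : Ω → ℂ := fun ω => A ω * Complex.exp (-(θ * p ω) * Complex.I)
  let A₁ : Ω → ℂ := fun ω => A₀ ω * (Complex.exp (θ * Complex.I) - 1)
  have hA₀ : Measurable[m] A₀ := hA.mul (hg.comp hp)
  have hA₁ : Measurable[m] A₁ := hA₀.mul measurable_const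
  have hn₀ : ∀ ω, ‖A₀ ω‖ ≤ 1 := fun ω => by
    simp only [A₀]
    rw [norm_mul, norm_exp_neg_mul_I, mul_one]
    exact hA1 ω
  have hn₁ : ∀ ω, ‖A₁ ω‖ ≤ 2 := fun ω => by
    have h2 : ‖Complex.exp (θ * Complex.I) - 1‖ ≤ 2 := by
      refine (norm_sub_le _ _).trans ?_
      rw [Complex.norm_exp_ofReal_mul_I]
      norm_num
    calc ‖A₁ ω‖ = ‖A₀ ω‖ * ‖Complex.exp (θ * Complex.I) - 1‖ := norm_mul _ _
      _ ≤ 1 * 2 := mul_le_mul (hn₀ ω) h2 (norm_nonneg _) zero_le_one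
      _ = 2 := one_mul 2
  have h1 := integral_mul_ite_le hm hm' h hYm hY hp hp01 hA₁ hn₁
  have hi₀ : Integrable A₀ P :=
    Integrable.of_bound (C := 1) (hA₀.mono hm le_rfl).aestronglyMeasurable (.of_forall hn₀)
  have hi₁ : Integrable (fun ω => A₁ ω * (if Y ω ≤ p ω then 1 else 0)) P := by
    refine Integrable.of_bound (C := 2) ((hA₁.mono hm le_rfl).mul (Measurable.ite
      (measurableSet_le hY' hp') measurable_const measurable_const)).aestronglyMeasurable
      (.of_forall fun ω => ?_)
    split_ifs <;> simp [hn₁ ω]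
  have hi₂ : Integrable (fun ω => A₁ ω * (p ω : ℂ)) P := by
    refine Integrable.of_bound (C := 2) ((hA₁.mono hm le_rfl).mul
      (Complex.measurable_ofReal.comp hp')).aestronglyMeasurable (.of_forall fun ω => ?_)
    rw [norm_mul, Complex.norm_real, Real.norm_of_nonneg (hp01 ω).1]
    exact (mul_le_of_le_one_right (norm_nonneg _) (hp01 ω).2).trans (hn₁ ω)
  calc ∫ ω, A ω * Complex.exp ((θ * bernoulliNoise (Y ω) (p ω) : ℝ) * Complex.I) ∂P
      = ∫ ω, (A₀ ω + A₁ ω * (if Y ω ≤ p ω then 1 else 0)) ∂P := by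
        refine integral_congr_ae (.of_forall fun ω => ?_)
        simp only [exp_bernoulliNoise, A₀, A₁]
        ring
    _ = ∫ ω, (A₀ ω + A₁ ω * (p ω : ℂ)) ∂P := by
        rw [integral_add hi₀ hi₁, integral_add hi₀ hi₂, h1]
    _ = _ := by
        refine integral_congr_ae (.of_forall fun ω => ?_)
        simp only [bernoulliCharFun, A₀, A₁]
        ring

end BernoulliIncrements

/-! ### All urns over one time step: conditional independence and orthogonality. -/

section OneStep

/-- The indices of the variables `U s i` with `s ≤ t`. -/
def past (t : ℕ) : Set (ℕ × ℕ) := {q | q.1 ≤ t}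

/-- The indices of the variables `U s i` with `s ≤ t`, or with `s = t + 1` and `i ∉ S`. -/
def pastExcept (t : ℕ) (S : Set ℕ) : Set (ℕ × ℕ) := {q | q.1 ≤ t ∨ q.1 = t + 1 ∧ q.2 ∉ S}

lemma past_subset_pastExcept (t : ℕ) (S : Set ℕ) : past t ⊆ pastExcept t S :=
  fun _ h => Or.inl h

lemma pastExcept_anti {t : ℕ} {S T : Set ℕ} (h : S ⊆ T) : pastExcept t T ⊆ pastExcept t S :=
  fun _ hq => hq.imp_right fun h' => ⟨h'.1, fun hS => h'.2 (h hS)⟩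

lemma disjoint_pastExcept (t i : ℕ) {S : Set ℕ} (hi : i ∈ S) :
    Disjoint (pastExcept t S) {(t + 1, i)} := by
  rw [Set.disjoint_singleton_right]
  rintro (h | h)
  · exact absurd h (by simp)
  · exact h.2 hi

variable {Ω : Type*} [mΩ : MeasurableSpace Ω] {P : Measure Ω} [IsProbabilityMeasure P]
  {U : ℕ → ℕ → Ω → ℝ} {t : ℕ} {p : ℕ → Ω → ℝ}

/-- Conditionally on the past up to time `t`, the increments at time `t + 1` are independent centred
Bernoulli variables. -/
lemma integral_mul_prod_exp_bernoulliNoise (hU_meas : ∀ t i, Measurable (U t i))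
    (hU_indep : iIndepFun (fun q : ℕ × ℕ => U q.1 q.2) P)
    (hU_law : ∀ t i, HasLaw (U t i) (volume.restrict (Set.Icc (0 : ℝ) 1)) P)
    (hp : ∀ i, Measurable[generated (fun q : ℕ × ℕ => U q.1 q.2) (past t)] (p i))
    (hp01 : ∀ i ω, p i ω ∈ Set.Icc (0 : ℝ) 1) (θ : ℝ) (s : Finset ℕ) {A : Ω → ℂ}
    (hA : Measurable[generated (fun q : ℕ × ℕ => U q.1 q.2) (pastExcept t s)] A)
    (hA1 : ∀ ω, ‖A ω‖ ≤ 1) :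
    ∫ ω, A ω * ∏ i ∈ s, Complex.exp ((θ * bernoulliNoise (U (t + 1) i ω) (p i ω) : ℝ)
        * Complex.I) ∂P
      = ∫ ω, A ω * ∏ i ∈ s, bernoulliCharFun (p i ω) θ ∂P := by
  classical
  have hU : ∀ q : ℕ × ℕ, Measurable (U q.1 q.2) := fun q => hU_meas _ _
  have hcf : Measurable fun x : ℝ => bernoulliCharFun x θ := by
    unfold bernoulliCharFun; fun_prop
  -- The factor of urn `j` is first absorbed into `A`, which is allowed to depend on time `t + 1`
  -- variables outside `s`. Once the other urns are integrated out, their factors depend only on the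
  -- past, and urn `j` can be integrated last.
  induction s using Finset.induction_on generalizing A with
  | empty => simp
  | insert j s hj ih =>
    have hexp : Measurable fun z : ℝ × ℝ =>
        Complex.exp ((θ * bernoulliNoise z.1 z.2 : ℝ) * Complex.I) := by
      have := measurable_bernoulliNoise
      fun_prop
    have hYj : Measurable[generated (fun q : ℕ × ℕ => U q.1 q.2) (pastExcept t s)]
        (U (t + 1) j) :=
      measurable_generated (U := fun q : ℕ × ℕ => U q.1 q.2) (i := (t + 1, j))
        (Or.inr ⟨rfl, by simpa using hj⟩)
    have hsub : pastExcept t ((insert j s : Finset ℕ) : Set ℕ) ⊆ pastExcept t s :=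
      pastExcept_anti (by simp)
    have hE : Measurable[generated (fun q : ℕ × ℕ => U q.1 q.2) (pastExcept t s)]
        fun ω => A ω * Complex.exp ((θ * bernoulliNoise (U (t + 1) j ω) (p j ω) : ℝ)
          * Complex.I) :=
      (hA.mono (generated_mono hsub) le_rfl).mul (hexp.comp (hYj.prodMk
        ((hp j).mono (generated_mono (past_subset_pastExcept t s)) le_rfl)))
    have h1 := ih hE fun ω => by
      rw [norm_mul, Complex.norm_exp_ofReal_mul_I, mul_one]
      exact hA1 ω
    have hQ : Measurable[generated (fun q : ℕ × ℕ => U q.1 q.2)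
        (pastExcept t ((insert j s : Finset ℕ) : Set ℕ))]
        fun ω => A ω * ∏ i ∈ s, bernoulliCharFun (p i ω) θ :=
      hA.mul (Finset.measurable_fun_prod s fun i _ => hcf.comp
        ((hp i).mono (generated_mono (past_subset_pastExcept t _)) le_rfl))
    have h2 := integral_mul_exp_bernoulliNoise (generated_le hU) (generated_le hU)
      (indep_generated hU hU_indep (disjoint_pastExcept t j
        (S := ((insert j s : Finset ℕ) : Set ℕ)) (by simp)))
      (measurable_generated (U := fun q : ℕ × ℕ => U q.1 q.2)
        (Set.mem_singleton (t + 1, j))) (hU_law (t + 1) j)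
      ((hp j).mono (generated_mono (past_subset_pastExcept t _)) le_rfl) (hp01 j) hQ
      (fun ω => by
        rw [norm_mul]
        exact mul_le_one₀ (hA1 ω) (norm_nonneg _)
          (norm_prod_le_one _ _ fun i _ => norm_bernoulliCharFun_le (hp01 i ω) θ)) θ
    calc _ = ∫ ω, A ω * Complex.exp ((θ * bernoulliNoise (U (t + 1) j ω) (p j ω) : ℝ)
          * Complex.I) * ∏ i ∈ s, Complex.exp ((θ * bernoulliNoise (U (t + 1) i ω) (p i ω) : ℝ)
          * Complex.I) ∂P := by
            simp_rw [Finset.prod_insert hj, mul_assoc]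
      _ = _ := h1
      _ = ∫ ω, A ω * (∏ i ∈ s, bernoulliCharFun (p i ω) θ)
          * Complex.exp ((θ * bernoulliNoise (U (t + 1) j ω) (p j ω) : ℝ) * Complex.I) ∂P := by
            simp_rw [mul_right_comm]
      _ = _ := h2
      _ = _ := by
            simp_rw [Finset.prod_insert hj]
            refine integral_congr_ae (.of_forall fun ω => ?_)
            ring

/-- The second moment of a sum of orthogonal increments. -/
lemma integral_sq_sum_bernoulliNoise_le (hU_meas : ∀ t i, Measurable (U t i))
    (hU_indep : iIndepFun (fun q : ℕ × ℕ => U q.1 q.2) P)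
    (hU_law : ∀ t i, HasLaw (U t i) (volume.restrict (Set.Icc (0 : ℝ) 1)) P)
    (hp : ∀ i, Measurable[generated (fun q : ℕ × ℕ => U q.1 q.2) (past t)] (p i))
    (hp01 : ∀ i ω, p i ω ∈ Set.Icc (0 : ℝ) 1) (s : Finset ℕ) {c : ℕ → Ω → ℝ}
    (hc : ∀ i, Measurable[generated (fun q : ℕ × ℕ => U q.1 q.2) (past t)] (c i))
    {C : ℝ} (hC : ∀ i ω, |c i ω| ≤ C) :
    ∫ ω, (∑ i ∈ s, c i ω * bernoulliNoise (U (t + 1) i ω) (p i ω)) ^ 2 ∂P ≤ s.card * C ^ 2 := by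
  have hU : ∀ q : ℕ × ℕ, Measurable (U q.1 q.2) := fun q => hU_meas _ _
  have hC0 : ∀ i : ℕ, ∀ ω : Ω, 0 ≤ C := fun i ω => (abs_nonneg _).trans (hC i ω)
  set f : ℕ → Ω → ℝ := fun i ω => c i ω * bernoulliNoise (U (t + 1) i ω) (p i ω) with hf
  have hfm : ∀ i, Measurable (f i) := fun i =>
    ((hc i).mono (generated_le hU) le_rfl).mul (measurable_bernoulliNoise.comp
      ((hU_meas (t + 1) i).prodMk ((hp i).mono (generated_le hU) le_rfl)))
  have hfb : ∀ i ω, |f i ω| ≤ C := fun i ω => by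
    rw [hf, abs_mul]
    exact (mul_le_of_le_one_right (abs_nonneg _) (abs_bernoulliNoise_le (hp01 i ω))).trans (hC i ω)
  have hffb : ∀ i j ω, |f i ω * f j ω| ≤ C ^ 2 := fun i j ω => by
    rw [abs_mul, sq]
    exact mul_le_mul (hfb i ω) (hfb j ω) (abs_nonneg _) (hC0 i ω)
  have hint : ∀ i j, Integrable (fun ω => f i ω * f j ω) P := fun i j =>
    Integrable.of_bound (C := C ^ 2) ((hfm i).mul (hfm j)).aestronglyMeasurable
      (.of_forall (hffb i j))
  -- Everything in the product except the noise of urn `i` is measurable without `U (t + 1) i`.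
  have horth : ∀ i j, j ≠ i → ∫ ω, f i ω * f j ω ∂P = 0 := by
    intro i j hji
    have hsub : generated (fun q : ℕ × ℕ => U q.1 q.2) (past t)
        ≤ generated (fun q : ℕ × ℕ => U q.1 q.2) (pastExcept t {i}) :=
      generated_mono (past_subset_pastExcept t {i})
    have hYj : Measurable[generated (fun q : ℕ × ℕ => U q.1 q.2) (pastExcept t {i})]
        (U (t + 1) j) :=
      measurable_generated (U := fun q : ℕ × ℕ => U q.1 q.2) (i := (t + 1, j))
        (Or.inr ⟨rfl, by simpa using hji⟩)
    have hA : Measurable[generated (fun q : ℕ × ℕ => U q.1 q.2) (pastExcept t {i})]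
        fun ω => c i ω * f j ω :=
      ((hc i).mono hsub le_rfl).mul (((hc j).mono hsub le_rfl).mul
        (measurable_bernoulliNoise.comp (hYj.prodMk ((hp j).mono hsub le_rfl))))
    have h := integral_mul_bernoulliNoise (generated_le hU) (generated_le hU)
      (indep_generated hU hU_indep (disjoint_pastExcept t i (Set.mem_singleton i)))
      (measurable_generated (U := fun q : ℕ × ℕ => U q.1 q.2)
        (Set.mem_singleton (t + 1, i))) (hU_law (t + 1) i)
      ((hp i).mono hsub le_rfl) (hp01 i) hA (C := C ^ 2) (fun ω => by
        rw [abs_mul, sq]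
        exact mul_le_mul (hC i ω) (hfb j ω) (abs_nonneg _) (hC0 i ω))
    rw [← h]
    refine integral_congr_ae (.of_forall fun ω => ?_)
    simp only [hf]
    ring
  have hsq : ∀ ω, (∑ i ∈ s, f i ω) ^ 2 = ∑ i ∈ s, ∑ j ∈ s, f i ω * f j ω := fun ω => by
    rw [sq, Finset.sum_mul_sum]
  calc ∫ ω, (∑ i ∈ s, f i ω) ^ 2 ∂P = ∑ i ∈ s, ∑ j ∈ s, ∫ ω, f i ω * f j ω ∂P := by
        simp_rw [hsq]
        rw [integral_finsetSum _ fun i _ => integrable_finsetSum _ fun j _ => hint i j]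
        exact Finset.sum_congr rfl fun i _ => integral_finsetSum _ fun j _ => hint i j
    _ = ∑ i ∈ s, ∫ ω, f i ω * f i ω ∂P := by
        refine Finset.sum_congr rfl fun i hi => ?_
        exact Finset.sum_eq_single_of_mem i hi fun j _ hji => horth i j hji
    _ ≤ ∑ _i ∈ s, C ^ 2 := by
        refine Finset.sum_le_sum fun i _ => ?_
        have h1 := norm_integral_le_of_norm_le_const (μ := P)
          (f := fun ω => f i ω * f i ω) (.of_forall (hffb i i))
        simp only [probReal_univ, mul_one] at h1
        exact (le_abs_self _).trans h1
    _ = s.card * C ^ 2 := by simp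

end OneStep

/-! ### Algebra of convergence in mean to constants. -/

section MeanConvergence

variable {Ω : Type*} [MeasurableSpace Ω]

/-- Convergence in mean of a uniformly bounded sequence of random variables to a constant. -/
structure TendstoInMean (P : Measure Ω) (f : ℕ → Ω → ℝ) (c : ℝ) : Prop where
  measurable : ∀ n, Measurable (f n)
  bounded : ∃ C, ∀ n ω, |f n ω| ≤ C
  tendsto : Tendsto (fun n => ∫ ω, |f n ω - c| ∂P) atTop (𝓝 0)

variable {P : Measure Ω} [IsProbabilityMeasure P] {f g : ℕ → Ω → ℝ} {c d : ℝ}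

lemma TendstoInMean.integrable (hf : TendstoInMean P f c) (n : ℕ) :
    Integrable (fun ω => |f n ω - c|) P := by
  obtain ⟨C, hC⟩ := hf.bounded
  refine (Integrable.sub (Integrable.of_bound (C := C) (hf.measurable n).aestronglyMeasurable
    (.of_forall (hC n))) (integrable_const c)).abs

/-- Convergence in mean of a sequence whose distance to its limit is dominated by those of
two sequences that converge in mean. -/
lemma TendstoInMean.of_le (hf : TendstoInMean P f c) (hg : TendstoInMean P g d) {h : ℕ → Ω → ℝ}
    {e : ℝ} (hm : ∀ n, Measurable (h n)) (hb : ∃ C, ∀ n ω, |h n ω| ≤ C) (K L : ℝ)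
    (hle : ∀ n ω, |h n ω - e| ≤ K * |f n ω - c| + L * |g n ω - d|) : TendstoInMean P h e := by
  refine ⟨hm, hb, ?_⟩
  have h1 := (hf.tendsto.const_mul K).add (hg.tendsto.const_mul L)
  rw [mul_zero, mul_zero, add_zero] at h1
  refine squeeze_zero (fun n => integral_nonneg fun ω => abs_nonneg _) (fun n => ?_) h1
  rw [← integral_const_mul, ← integral_const_mul,
    ← integral_add ((hf.integrable n).const_mul K) ((hg.integrable n).const_mul L)]
  exact integral_mono_of_nonneg (.of_forall fun ω => abs_nonneg _)
    (((hf.integrable n).const_mul K).add ((hg.integrable n).const_mul L)) (.of_forall (hle n))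

lemma TendstoInMean.add (hf : TendstoInMean P f c) (hg : TendstoInMean P g d) :
    TendstoInMean P (fun n ω => f n ω + g n ω) (c + d) := by
  obtain ⟨C, hC⟩ := hf.bounded
  obtain ⟨D, hD⟩ := hg.bounded
  refine hf.of_le hg (fun n => (hf.measurable n).add (hg.measurable n))
    ⟨C + D, fun n ω => (abs_add_le _ _).trans (add_le_add (hC n ω) (hD n ω))⟩ 1 1 fun n ω => ?_
  rw [one_mul, one_mul, add_sub_add_comm]
  exact abs_add_le _ _

lemma TendstoInMean.const_mul (k : ℝ) (hf : TendstoInMean P f c) :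
    TendstoInMean P (fun n ω => k * f n ω) (k * c) := by
  obtain ⟨C, hC⟩ := hf.bounded
  refine hf.of_le hf (fun n => (hf.measurable n).const_mul k)
    ⟨|k| * C, fun n ω => ?_⟩ |k| 0 fun n ω => ?_
  · rw [abs_mul]
    exact mul_le_mul_of_nonneg_left (hC n ω) (abs_nonneg k)
  · rw [← mul_sub, abs_mul, zero_mul, add_zero]

/-- On a bounded range squaring is Lipschitz; this is why uniform bounds are part of
`TendstoInMean`. -/
lemma TendstoInMean.sq (hf : TendstoInMean P f c) :
    TendstoInMean P (fun n ω => f n ω ^ 2) (c ^ 2) := by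
  obtain ⟨C, hC⟩ := hf.bounded
  refine hf.of_le hf (fun n => (hf.measurable n).pow_const 2)
    ⟨C ^ 2, fun n ω => ?_⟩ (C + |c|) 0 fun n ω => ?_
  · rw [abs_pow]
    exact pow_le_pow_left₀ (abs_nonneg _) (hC n ω) 2
  · have h1 : f n ω ^ 2 - c ^ 2 = (f n ω + c) * (f n ω - c) := by ring
    rw [h1, abs_mul, zero_mul, add_zero]
    exact mul_le_mul_of_nonneg_right ((abs_add_le _ _).trans (by linarith [hC n ω]))
      (abs_nonneg _)

end MeanConvergence

/-! ### Averages over the urns. -/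

section Average

/-- The common form of the averages computed below. Writing the constant term as a multiple of
`average N z` keeps the identity true at `N = 0`, where every average is `0`. -/
lemma average_quadratic (N : ℕ) (z e : ℕ → ℝ) (k c₁ c₂ : ℝ) :
    average N (fun i => k * average N z + c₁ * z i + c₂ * z i ^ 2 + e i)
      = (k + c₁) * average N z + c₂ * average N (fun i => z i ^ 2) + average N e := by
  rcases Nat.eq_zero_or_pos N with rfl | hN
  · simp [average]
  have hN' : (N : ℝ) ≠ 0 := by positivity
  simp only [average, Finset.sum_add_distrib, ← Finset.mul_sum, Finset.sum_const, Nat.card_Icc,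
    add_tsub_cancel_right, nsmul_eq_mul]
  field_simp

lemma average_const {N : ℕ} (hN : 0 < N) (c : ℝ) : average N (fun _ => c) = c := by
  have hN' : (N : ℝ) ≠ 0 := by positivity
  simp only [average, Finset.sum_const, Nat.card_Icc, add_tsub_cancel_right, nsmul_eq_mul]
  field_simp

lemma average_mem_Icc {N : ℕ} {z : ℕ → ℝ} (hz : ∀ i, z i ∈ Set.Icc (0 : ℝ) 1) :
    average N z ∈ Set.Icc (0 : ℝ) 1 := by
  refine ⟨div_nonneg (Finset.sum_nonneg fun i _ => (hz i).1) N.cast_nonneg, ?_⟩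
  refine div_le_one_of_le₀ ?_ N.cast_nonneg
  calc ∑ i ∈ Finset.Icc 1 N, z i ≤ ∑ _i ∈ Finset.Icc 1 N, (1 : ℝ) :=
        Finset.sum_le_sum fun i _ => (hz i).2
    _ = N := by simp

lemma measurable_average {Ω : Type*} {_ : MeasurableSpace Ω} {N : ℕ} {z : ℕ → Ω → ℝ}
    (hz : ∀ i, Measurable (z i)) : Measurable fun ω => average N fun i => z i ω :=
  (Finset.measurable_fun_sum _ fun i _ => hz i).div_const _

lemma abs_average_le {N : ℕ} {z : ℕ → ℝ} {C : ℝ} (hC : 0 ≤ C) (hz : ∀ i, |z i| ≤ C) :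
    |average N z| ≤ C := by
  rw [average, abs_div, Nat.abs_cast]
  refine div_le_of_le_mul₀ N.cast_nonneg hC ((Finset.abs_sum_le_sum_abs _ _).trans ?_)
  calc ∑ i ∈ Finset.Icc 1 N, |z i| ≤ ∑ _i ∈ Finset.Icc 1 N, C := Finset.sum_le_sum fun i _ => hz i
    _ = C * N := by simp [mul_comm]

end Average

/-! ### Exact one-step recursions for the urn system. -/

section Urns

variable {Ω : Type*} (a b : ℕ) (α : ℝ) (N : ℕ) (U : ℕ → ℕ → Ω → ℝ)

/-- The fraction of red balls in urn `i` at time `t`. -/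
noncomputable def urnFraction (t i : ℕ) (ω : Ω) : ℝ :=
  fraction a b t (redBalls a b α N U t i ω)

/-- The probability of drawing a red ball for urn `i` at time `t + 1`, given the past. -/
noncomputable def drawProb (t i : ℕ) (ω : Ω) : ℝ :=
  α * totalFraction a b α N U t ω + (1 - α) * urnFraction a b α N U t i ω

/-- The centred increment of the number of red balls in urn `i` between `t` and `t + 1`. -/
noncomputable def noise (t i : ℕ) (ω : Ω) : ℝ :=
  bernoulliNoise (U (t + 1) i ω) (drawProb a b α N U t i ω)

/-- The average of the squares of the fractions of red balls at time `t`. -/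
noncomputable def meanSquare (t : ℕ) (ω : Ω) : ℝ :=
  average N fun i => urnFraction a b α N U t i ω ^ 2

variable {a b α N U}

lemma totalFraction_eq (t : ℕ) (ω : Ω) :
    totalFraction a b α N U t ω = average N fun i => urnFraction a b α N U t i ω := rfl

lemma redBalls_le (t i : ℕ) (ω : Ω) : redBalls a b α N U t i ω ≤ t + a := by
  induction t with
  | zero => simp [redBalls]
  | succ t ih =>
    rw [redBalls]
    split_ifs <;> omega

lemma urnFraction_mem_Icc (t i : ℕ) (ω : Ω) :
    urnFraction a b α N U t i ω ∈ Set.Icc (0 : ℝ) 1 := by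
  have h : (redBalls a b α N U t i ω : ℝ) ≤ t + a := by exact_mod_cast redBalls_le t i ω
  have hb : (0 : ℝ) ≤ b := b.cast_nonneg
  exact ⟨div_nonneg (Nat.cast_nonneg _) (by positivity),
    div_le_one_of_le₀ (by linarith) (by positivity)⟩

lemma totalFraction_mem_Icc (t : ℕ) (ω : Ω) :
    totalFraction a b α N U t ω ∈ Set.Icc (0 : ℝ) 1 :=
  average_mem_Icc fun i => urnFraction_mem_Icc t i ω

lemma meanSquare_mem_Icc (t : ℕ) (ω : Ω) : meanSquare a b α N U t ω ∈ Set.Icc (0 : ℝ) 1 :=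
  average_mem_Icc fun i => ⟨sq_nonneg _,
    pow_le_one₀ (urnFraction_mem_Icc t i ω).1 (urnFraction_mem_Icc t i ω).2⟩

lemma drawProb_mem_Icc (hα : α ∈ Set.Icc (0 : ℝ) 1) (t i : ℕ) (ω : Ω) :
    drawProb a b α N U t i ω ∈ Set.Icc (0 : ℝ) 1 :=
  (convex_Icc (0 : ℝ) 1) (totalFraction_mem_Icc t ω) (urnFraction_mem_Icc t i ω) hα.1
    (sub_nonneg.2 hα.2) (by ring)

lemma measurable_redBalls (t i : ℕ) :
    Measurable[generated (fun q : ℕ × ℕ => U q.1 q.2) (past t)] (redBalls a b α N U t i) := by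
  induction t generalizing i with
  | zero => exact measurable_const
  | succ t ih =>
    have hle : generated (fun q : ℕ × ℕ => U q.1 q.2) (past t)
        ≤ generated (fun q : ℕ × ℕ => U q.1 q.2) (past (t + 1)) :=
      generated_mono fun q (hq : q.1 ≤ t) => Nat.le_succ_of_le hq
    have hz : ∀ j, Measurable[generated (fun q : ℕ × ℕ => U q.1 q.2) (past (t + 1))]
        fun ω => fraction a b t (redBalls a b α N U t j ω) := fun j =>
      (measurable_from_top (f := fun x : ℕ => fraction a b t x)).comp ((ih j).mono hle le_rfl)
    have hU : Measurable[generated (fun q : ℕ × ℕ => U q.1 q.2) (past (t + 1))] (U (t + 1) i) :=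
      measurable_generated (U := fun q : ℕ × ℕ => U q.1 q.2) (i := (t + 1, i))
        (show t + 1 ≤ t + 1 from le_rfl)
    let _ := generated (fun q : ℕ × ℕ => U q.1 q.2) (past (t + 1))
    exact ((ih i).mono hle le_rfl).add (Measurable.ite (measurableSet_le hU
      (((measurable_average hz).const_mul α).add ((hz i).const_mul (1 - α))))
      measurable_const measurable_const)

lemma measurable_urnFraction (t i : ℕ) :
    Measurable[generated (fun q : ℕ × ℕ => U q.1 q.2) (past t)] (urnFraction a b α N U t i) :=
  (measurable_from_top (f := fun x : ℕ => fraction a b t x)).comp (measurable_redBalls t i)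

lemma measurable_totalFraction (t : ℕ) :
    Measurable[generated (fun q : ℕ × ℕ => U q.1 q.2) (past t)] (totalFraction a b α N U t) :=
  measurable_average (measurable_urnFraction t)

lemma measurable_meanSquare (t : ℕ) :
    Measurable[generated (fun q : ℕ × ℕ => U q.1 q.2) (past t)] (meanSquare a b α N U t) :=
  measurable_average fun i => (measurable_urnFraction t i).pow_const 2

lemma measurable_drawProb (t i : ℕ) :
    Measurable[generated (fun q : ℕ × ℕ => U q.1 q.2) (past t)] (drawProb a b α N U t i) :=
  ((measurable_totalFraction t).const_mul α).add ((measurable_urnFraction t i).const_mul (1 - α))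

lemma measurable_fluctuation {s t : ℕ} (hst : s ≤ t) :
    Measurable[generated (fun q : ℕ × ℕ => U q.1 q.2) (past t)] (fluctuation a b α N U s) :=
  (((measurable_totalFraction s).sub_const _).const_mul _).mono
    (generated_mono fun _ (hq : _ ≤ s) => hq.trans hst) le_rfl

lemma urnFraction_succ (ha : 1 ≤ a) (t i : ℕ) (ω : Ω) :
    urnFraction a b α N U (t + 1) i ω = urnFraction a b α N U t i ω
      + (noise a b α N U t i ω + drawProb a b α N U t i ω - urnFraction a b α N U t i ω)
        / ((t : ℝ) + ((a : ℝ) + (b : ℝ)) + 1) := by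
  have ha' : (1 : ℝ) ≤ a := by exact_mod_cast ha
  have h1 : (t : ℝ) + ((a : ℝ) + (b : ℝ)) ≠ 0 := by positivity
  have h2 : (t : ℝ) + ((a : ℝ) + (b : ℝ)) + 1 ≠ 0 := by positivity
  have h3 : noise a b α N U t i ω + drawProb a b α N U t i ω
      = if U (t + 1) i ω ≤ drawProb a b α N U t i ω then 1 else 0 := by
    rw [noise, bernoulliNoise, sub_add_cancel]
  have h4 : (redBalls a b α N U (t + 1) i ω : ℝ) = redBalls a b α N U t i ω
      + if U (t + 1) i ω ≤ drawProb a b α N U t i ω then 1 else 0 := by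
    rw [redBalls]
    push_cast
    rfl
  rw [h3, urnFraction, urnFraction, fraction, fraction, h4]
  push_cast
  field_simp
  ring

/-- The martingale property: the draw probabilities average to the total fraction, so the drift
cancels and only noise remains. -/
lemma totalFraction_succ (ha : 1 ≤ a) (t : ℕ) (ω : Ω) :
    totalFraction a b α N U (t + 1) ω = totalFraction a b α N U t ω
      + 1 / ((t : ℝ) + ((a : ℝ) + (b : ℝ)) + 1) * average N fun i => noise a b α N U t i ω := by
  have h := average_quadratic N (fun i => urnFraction a b α N U t i ω)
    (fun i => 1 / ((t : ℝ) + ((a : ℝ) + (b : ℝ)) + 1) * noise a b α N U t i ω)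
    (α / ((t : ℝ) + ((a : ℝ) + (b : ℝ)) + 1))
    (1 - α / ((t : ℝ) + ((a : ℝ) + (b : ℝ)) + 1)) 0
  have h2 : average N (fun i => 1 / ((t : ℝ) + ((a : ℝ) + (b : ℝ)) + 1) * noise a b α N U t i ω)
      = 1 / ((t : ℝ) + ((a : ℝ) + (b : ℝ)) + 1) * average N fun i => noise a b α N U t i ω := by
    rw [average, average, ← Finset.mul_sum, mul_div_assoc]
  rw [← totalFraction_eq, h2] at h
  calc totalFraction a b α N U (t + 1) ω = _ := by
        rw [totalFraction_eq]
        congr 1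
        ext i
        rw [urnFraction_succ ha, drawProb]
        ring
    _ = _ := h
    _ = _ := by ring

/-- The sum is an indicator, hence idempotent. This makes the recursion for the mean square linear
in the noise. -/
lemma noise_sq (t i : ℕ) (ω : Ω) :
    (noise a b α N U t i ω + drawProb a b α N U t i ω) ^ 2
      = noise a b α N U t i ω + drawProb a b α N U t i ω := by
  rw [noise, bernoulliNoise, sub_add_cancel]
  split_ifs <;> simp

/-- Square `urnFraction_succ`, reduce with `noise_sq` and average. The nesting and the factors `-1`
match the operations available for `TendstoInMean`. -/
lemma meanSquare_succ (ha : 1 ≤ a) (t : ℕ) (ω : Ω) :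
    meanSquare a b α N U (t + 1) ω = meanSquare a b α N U t ω
      + (2 * α / ((t : ℝ) + ((a : ℝ) + (b : ℝ)) + 1)
          * (totalFraction a b α N U t ω ^ 2 + -1 * meanSquare a b α N U t ω)
        + (1 / ((t : ℝ) + ((a : ℝ) + (b : ℝ)) + 1) ^ 2
            * (totalFraction a b α N U t ω + (-(2 * α) * totalFraction a b α N U t ω ^ 2
              + (2 * α - 1) * meanSquare a b α N U t ω))
          + average N fun i => (2 * urnFraction a b α N U t i ω
              / ((t : ℝ) + ((a : ℝ) + (b : ℝ)) + 1)
            + (1 - 2 * urnFraction a b α N U t i ω) / ((t : ℝ) + ((a : ℝ) + (b : ℝ)) + 1) ^ 2)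
            * noise a b α N U t i ω)) := by
  set y : ℝ := ((t : ℝ) + ((a : ℝ) + (b : ℝ)) + 1)⁻¹ with hy
  set Z := totalFraction a b α N U t ω with hZ
  set e : ℕ → ℝ := fun i => (2 * urnFraction a b α N U t i ω
      / ((t : ℝ) + ((a : ℝ) + (b : ℝ)) + 1)
    + (1 - 2 * urnFraction a b α N U t i ω) / ((t : ℝ) + ((a : ℝ) + (b : ℝ)) + 1) ^ 2)
    * noise a b α N U t i ω with he
  -- The three coefficients are those of `1`, `z` and `z^2` in `z^2 + 2z(p - z)y + (p - 2pz +
  -- z^2)y^2` with `p = αZ + (1 - α)z`; the constant one has a factor `Z` removed.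
  have h := average_quadratic N (fun i => urnFraction a b α N U t i ω) e
    (α * y ^ 2)
    (2 * α * Z * y + (1 - α) * y ^ 2 - 2 * α * Z * y ^ 2)
    (1 - 2 * α * y + (2 * α - 1) * y ^ 2)
  rw [← totalFraction_eq, ← hZ] at h
  calc meanSquare a b α N U (t + 1) ω = _ := by
        rw [meanSquare]
        congr 1
        ext i
        have h1 := noise_sq (a := a) (b := b) (α := α) (N := N) (U := U) t i ω
        have h2 : (urnFraction a b α N U (t + 1) i ω) ^ 2
            = urnFraction a b α N U t i ω ^ 2
              + 2 * urnFraction a b α N U t i ω * (noise a b α N U t i ω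
                + drawProb a b α N U t i ω - urnFraction a b α N U t i ω) * y
              + ((noise a b α N U t i ω + drawProb a b α N U t i ω)
                - 2 * (noise a b α N U t i ω + drawProb a b α N U t i ω)
                  * urnFraction a b α N U t i ω
                + urnFraction a b α N U t i ω ^ 2) * y ^ 2 := by
          rw [urnFraction_succ ha, div_eq_mul_inv, ← hy]
          linear_combination y ^ 2 * h1
        rw [h2, he]
        simp only [div_eq_mul_inv, ← inv_pow, ← hy, drawProb, ← hZ]
        ring
    _ = _ := h
    _ = _ := by
        rw [meanSquare]
        simp only [div_eq_mul_inv, ← inv_pow, ← hy]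
        ring

/-- The draw probabilities have mean `Z` and deviations `(1 - α) (Z_i - Z)`, so their empirical
variance is `(1 - α)^2` times that of the fractions. This is the shape of `sigmaSq`. -/
lemma average_drawProb_mul (t : ℕ) (ω : Ω) :
    average N (fun i => drawProb a b α N U t i ω * (1 - drawProb a b α N U t i ω))
      = totalFraction a b α N U t ω + (-1 * totalFraction a b α N U t ω ^ 2
        + -(1 - α) ^ 2 * (meanSquare a b α N U t ω + -1 * totalFraction a b α N U t ω ^ 2)) := by
  set Z := totalFraction a b α N U t ω with hZ
  have h := average_quadratic N (fun i => urnFraction a b α N U t i ω) (fun _ => 0)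
    (α - α ^ 2 * Z) ((1 - α) - 2 * α * (1 - α) * Z) (-(1 - α) ^ 2)
  rw [← totalFraction_eq, ← hZ] at h
  calc _ = _ := by
        congr 1
        ext i
        rw [drawProb, ← hZ]
        ring
    _ = _ := h
    _ = _ := by
        rw [meanSquare]
        simp only [average, Finset.sum_const_zero, zero_div]
        ring

end Urns

/-! ### Law of large numbers for the fractions and the conditional variance. -/

section LawOfLargeNumbers

variable {Ω : Type*} [MeasurableSpace Ω] {P : Measure Ω} [IsProbabilityMeasure P]
  {a b : ℕ} {α : ℝ} {U : ℕ → ℕ → Ω → ℝ}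

lemma tendsto_sqrt_div_self : Tendsto (fun N : ℕ => √(N : ℝ) / N) atTop (𝓝 0) := by
  simp_rw [Real.sqrt_div_self]
  exact tendsto_inv_atTop_zero.comp (Real.tendsto_sqrt_atTop.comp tendsto_natCast_atTop_atTop)

lemma sqrt_div_self_sq_mul (N : ℕ) : (√(N : ℝ) / N) ^ 2 * N = if N = 0 then 0 else 1 := by
  split_ifs with h
  · simp [h]
  · have hN : (N : ℝ) ≠ 0 := by exact_mod_cast h
    rw [div_pow, Real.sq_sqrt N.cast_nonneg]
    field_simp

/-- The law of large numbers for weighted averages of the noise. -/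
lemma tendstoInMean_average_noise (hα : α ∈ Set.Icc (0 : ℝ) 1)
    (hU_meas : ∀ t i, Measurable (U t i))
    (hU_indep : iIndepFun (fun q : ℕ × ℕ => U q.1 q.2) P)
    (hU_law : ∀ t i, HasLaw (U t i) (volume.restrict (Set.Icc (0 : ℝ) 1)) P) (t : ℕ)
    {c : ℕ → ℕ → Ω → ℝ}
    (hc : ∀ N i, Measurable[generated (fun q : ℕ × ℕ => U q.1 q.2) (past t)] (c N i))
    {C : ℝ} (hC0 : 0 ≤ C) (hC : ∀ N i ω, |c N i ω| ≤ C) :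
    TendstoInMean P (fun N ω => average N fun i => c N i ω * noise a b α N U t i ω) 0 := by
  have hU : ∀ q : ℕ × ℕ, Measurable (U q.1 q.2) := fun q => hU_meas _ _
  have hm : ∀ N, Measurable fun ω => average N fun i => c N i ω * noise a b α N U t i ω :=
    fun N => measurable_average fun i => ((hc N i).mono (generated_le hU) le_rfl).mul
      (measurable_bernoulliNoise.comp ((hU_meas (t + 1) i).prodMk
        ((measurable_drawProb t i).mono (generated_le hU) le_rfl)))
  have hb : ∀ N ω, |average N fun i => c N i ω * noise a b α N U t i ω| ≤ C := fun N ω =>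
    abs_average_le hC0 fun i => by
      rw [abs_mul]
      exact (mul_le_of_le_one_right (abs_nonneg _)
        (abs_bernoulliNoise_le (drawProb_mem_Icc hα t i ω))).trans (hC N i ω)
  refine ⟨hm, ⟨C, hb⟩, ?_⟩
  have hlim : Tendsto (fun N : ℕ => (C ^ 2 + 1) / 2 * (√(N : ℝ) / N)) atTop (𝓝 0) := by
    simpa using tendsto_sqrt_div_self.const_mul ((C ^ 2 + 1) / 2)
  refine squeeze_zero' (.of_forall fun N => integral_nonneg fun ω => abs_nonneg _) ?_ hlim
  filter_upwards [eventually_gt_atTop 0] with N hN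
  have hN' : (0 : ℝ) < N := by exact_mod_cast hN
  set d : ℝ := √(N : ℝ) / N with hd
  have hd0 : 0 < d := by positivity
  have hdN : d ^ 2 * N = 1 := by rw [hd, sqrt_div_self_sq_mul, if_neg hN.ne']
  let S : Ω → ℝ := fun ω => ∑ i ∈ Finset.Icc 1 N, c N i ω * noise a b α N U t i ω
  -- With `d = N^(-1/2)` the average is `d^2 S`, and `d (d |S| - 1)^2 ≥ 0` bounds it by second
  -- moments. As the mean of `S^2` is at most `N C^2`, the total is of order `d`.
  have hS : ∀ ω, |(average N fun i => c N i ω * noise a b α N U t i ω) - 0|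
      ≤ d ^ 3 / 2 * S ω ^ 2 + d / 2 := fun ω => by
    have h1 : (average N fun i => c N i ω * noise a b α N U t i ω) = d ^ 2 * S ω := by
      rw [average, div_eq_iff hN'.ne', mul_right_comm, hdN, one_mul]
    rw [sub_zero, h1, abs_mul, abs_of_pos (pow_pos hd0 2), ← sq_abs (S ω)]
    nlinarith [sq_nonneg (d * |S ω| - 1)]
  have hSm : Measurable S := Finset.measurable_fun_sum _ fun i _ =>
    ((hc N i).mono (generated_le hU) le_rfl).mul
      (measurable_bernoulliNoise.comp ((hU_meas (t + 1) i).prodMk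
        ((measurable_drawProb t i).mono (generated_le hU) le_rfl)))
  have hSi : Integrable (fun ω => S ω ^ 2) P := by
    refine Integrable.of_bound (C := (N * C) ^ 2) (hSm.pow_const 2).aestronglyMeasurable
      (.of_forall fun ω => ?_)
    rw [Real.norm_eq_abs, abs_pow]
    refine pow_le_pow_left₀ (abs_nonneg _) ?_ 2
    have h1 : S ω = N * average N fun i => c N i ω * noise a b α N U t i ω := by
      rw [average, mul_div_cancel₀ _ hN'.ne']
    rw [h1, abs_mul, Nat.abs_cast]
    exact mul_le_mul_of_nonneg_left (hb N ω) hN'.le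
  have hS2 := integral_sq_sum_bernoulliNoise_le hU_meas hU_indep hU_law
    (p := drawProb a b α N U t) (measurable_drawProb t) (drawProb_mem_Icc hα t)
    (Finset.Icc 1 N) (hc N) (hC N)
  calc ∫ ω, |(average N fun i => c N i ω * noise a b α N U t i ω) - 0| ∂P
      ≤ ∫ ω, (d ^ 3 / 2 * S ω ^ 2 + d / 2) ∂P :=
        integral_mono_of_nonneg (.of_forall fun ω => abs_nonneg _)
          ((hSi.const_mul _).add (integrable_const _)) (.of_forall hS)
    _ = d ^ 3 / 2 * ∫ ω, S ω ^ 2 ∂P + d / 2 := by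
        rw [integral_add (hSi.const_mul _) (integrable_const _), integral_const_mul]
        simp
    _ ≤ d ^ 3 / 2 * (N * C ^ 2) + d / 2 := by
        have h3 : ∫ ω, S ω ^ 2 ∂P ≤ N * C ^ 2 := hS2.trans_eq (by simp)
        have h4 : 0 ≤ d ^ 3 / 2 := by positivity
        exact add_le_add_left (mul_le_mul_of_nonneg_left h3 h4) _
    _ = (C ^ 2 + 1) / 2 * d := by
        linear_combination C ^ 2 / 2 * d * hdN

/-- The exact recursions pass to the limit because their noise terms vanish in mean. Thus `xInf` is
the limiting empirical variance of the fractions. -/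
lemma tendstoInMean_fractions (ha : 1 ≤ a) (hα : α ∈ Set.Icc (0 : ℝ) 1)
    (hU_meas : ∀ t i, Measurable (U t i))
    (hU_indep : iIndepFun (fun q : ℕ × ℕ => U q.1 q.2) P)
    (hU_law : ∀ t i, HasLaw (U t i) (volume.restrict (Set.Icc (0 : ℝ) 1)) P) (t : ℕ) :
    TendstoInMean P (fun N => totalFraction a b α N U t) ((a : ℝ) / ((a : ℝ) + (b : ℝ))) ∧
    TendstoInMean P (fun N => meanSquare a b α N U t)
      (xInf a b α t + ((a : ℝ) / ((a : ℝ) + (b : ℝ))) ^ 2) := by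
  have hU : ∀ q : ℕ × ℕ, Measurable (U q.1 q.2) := fun q => hU_meas _ _
  have habs : ∀ x ∈ Set.Icc (0 : ℝ) 1, |x| ≤ 1 := fun x hx => abs_le.2 ⟨by linarith [hx.1], hx.2⟩
  induction t with
  | zero =>
    refine ⟨⟨fun N => (measurable_totalFraction 0).mono (generated_le hU) le_rfl,
        ⟨1, fun N ω => habs _ (totalFraction_mem_Icc 0 ω)⟩, ?_⟩,
      ⟨fun N => (measurable_meanSquare 0).mono (generated_le hU) le_rfl,
        ⟨1, fun N ω => habs _ (meanSquare_mem_Icc 0 ω)⟩, ?_⟩⟩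
    · refine tendsto_const_nhds.congr' ?_
      filter_upwards [eventually_gt_atTop 0] with N hN
      simp [totalFraction, redBalls, fraction, average_const hN]
    · refine tendsto_const_nhds.congr' ?_
      filter_upwards [eventually_gt_atTop 0] with N hN
      simp [meanSquare, urnFraction, redBalls, fraction, average_const hN, xInf]
  | succ t ih =>
    obtain ⟨hZ, hM⟩ := ih
    constructor
    · have h := hZ.add ((tendstoInMean_average_noise (a := a) (b := b) hα hU_meas hU_indep hU_law t
        (c := fun _ _ _ => 1) (fun _ _ => measurable_const) zero_le_one (by simp)).const_mul
        (1 / ((t : ℝ) + ((a : ℝ) + (b : ℝ)) + 1)))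
      simp only [one_mul] at h
      have e : (fun N => totalFraction a b α N U (t + 1)) = fun N ω => totalFraction a b α N U t ω
          + 1 / ((t : ℝ) + ((a : ℝ) + (b : ℝ)) + 1)
            * average N fun i => noise a b α N U t i ω := by
        ext N ω
        exact totalFraction_succ ha t ω
      rw [e]
      simpa using h
    · have hn : (1 : ℝ) ≤ (t : ℝ) + ((a : ℝ) + (b : ℝ)) + 1 := by
        have : (0 : ℝ) ≤ (t : ℝ) + ((a : ℝ) + (b : ℝ)) := by positivity
        linarith
      have hnoise := tendstoInMean_average_noise (a := a) (b := b) hα hU_meas hU_indep hU_law t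
        (c := fun N i ω => 2 * urnFraction a b α N U t i ω
              / ((t : ℝ) + ((a : ℝ) + (b : ℝ)) + 1)
            + (1 - 2 * urnFraction a b α N U t i ω) / ((t : ℝ) + ((a : ℝ) + (b : ℝ)) + 1) ^ 2)
        (fun N i => by
          have h1 := measurable_urnFraction (a := a) (b := b) (α := α) (N := N) (U := U) t i
          exact ((h1.const_mul 2).div_const _).add (((h1.const_mul 2).const_sub 1).div_const _))
        -- The weight is at most `2 + 1`: its numerators are bounded by `2` and `1`, its
        -- denominators are at least `1`.
        (C := 3) (by norm_num) (fun N i ω => by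
          obtain ⟨h0, h1⟩ := urnFraction_mem_Icc (a := a) (b := b) (α := α) (N := N) (U := U) t i ω
          have h2 : |2 * urnFraction a b α N U t i ω| ≤ 2 := by
            rw [abs_of_nonneg (by positivity)]; linarith
          have h3 : |1 - 2 * urnFraction a b α N U t i ω| ≤ 1 := by
            rw [abs_le]; constructor <;> linarith
          refine (abs_add_le _ _).trans ?_
          rw [abs_div, abs_div, abs_of_nonneg (zero_le_one.trans hn),
            abs_of_nonneg (pow_nonneg (zero_le_one.trans hn) 2)]
          have h4 := (div_le_self (abs_nonneg _) hn).trans h2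
          have h5 := (div_le_self (abs_nonneg _) (one_le_pow₀ hn (n := 2))).trans h3
          linarith)
      have h := hM.add (((hZ.sq.add (hM.const_mul (-1))).const_mul
          (2 * α / ((t : ℝ) + ((a : ℝ) + (b : ℝ)) + 1))).add
        (((hZ.add ((hZ.sq.const_mul (-(2 * α))).add (hM.const_mul (2 * α - 1)))).const_mul
          (1 / ((t : ℝ) + ((a : ℝ) + (b : ℝ)) + 1) ^ 2)).add hnoise))
      have e : (fun N => meanSquare a b α N U (t + 1)) = _ :=
        funext fun N => funext fun ω => meanSquare_succ ha t ω
      rw [e]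
      convert h using 1
      rw [xInf, ← div_pow]
      ring

/-- The law of large numbers for the conditional variance of the increments. -/
lemma tendstoInMean_variance (ha : 1 ≤ a) (hα : α ∈ Set.Icc (0 : ℝ) 1)
    (hU_meas : ∀ t i, Measurable (U t i))
    (hU_indep : iIndepFun (fun q : ℕ × ℕ => U q.1 q.2) P)
    (hU_law : ∀ t i, HasLaw (U t i) (volume.restrict (Set.Icc (0 : ℝ) 1)) P) (t : ℕ) :
    TendstoInMean P (fun N ω => average N fun i =>
        drawProb a b α N U t i ω * (1 - drawProb a b α N U t i ω))
      (((t : ℝ) + ((a : ℝ) + (b : ℝ)) + 1) ^ 2 * sigmaSq a b α t) := by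
  obtain ⟨hZ, hM⟩ := tendstoInMean_fractions (b := b) ha hα hU_meas hU_indep hU_law t
  have h := hZ.add ((hZ.sq.const_mul (-1)).add
    ((hM.add (hZ.sq.const_mul (-1))).const_mul (-(1 - α) ^ 2)))
  have e : (fun (N : ℕ) ω => average N fun i =>
      drawProb a b α N U t i ω * (1 - drawProb a b α N U t i ω)) = _ :=
    funext fun N => funext fun ω => average_drawProb_mul t ω
  rw [e]
  convert h using 1
  have hn : (t : ℝ) + ((a : ℝ) + (b : ℝ)) + 1 ≠ 0 := by positivity
  rw [sigmaSq, ← div_pow, ← mul_assoc, mul_one_div_cancel (pow_ne_zero 2 hn)]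
  ring

end LawOfLargeNumbers

/-! ### Convergence of characteristic functions. -/

section CharacteristicFunctions

variable {Ω : Type*} {a b : ℕ} {α : ℝ} {U : ℕ → ℕ → Ω → ℝ}

lemma fluctuation_zero (N : ℕ) (ω : Ω) : fluctuation a b α N U 0 ω = 0 := by
  rcases Nat.eq_zero_or_pos N with rfl | hN
  · simp [fluctuation]
  · simp [fluctuation, totalFraction, redBalls, fraction, average_const hN]

lemma exp_fluctuation_succ (ha : 1 ≤ a) (N t : ℕ) (x : ℝ) (ω : Ω) :
    Complex.exp ((x * (fluctuation a b α N U (t + 1) ω - fluctuation a b α N U t ω) : ℝ)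
        * Complex.I)
      = ∏ i ∈ Finset.Icc 1 N, Complex.exp ((x / ((t : ℝ) + ((a : ℝ) + (b : ℝ)) + 1)
          * (√(N : ℝ) / N) * bernoulliNoise (U (t + 1) i ω) (drawProb a b α N U t i ω) : ℝ)
          * Complex.I) := by
  rw [← Complex.exp_sum, ← Finset.sum_mul, ← Complex.ofReal_sum, ← Finset.mul_sum]
  congr 3
  rw [fluctuation, fluctuation, totalFraction_succ ha, average]
  simp only [noise]
  ring

/-- For `N > 0` each exponent carries the weight `y^2 / N`, so the Gaussian factors multiply to one
depending only on the average conditional variance. -/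
lemma prod_exp_drawProb (N t : ℕ) (y : ℝ) (ω : Ω) :
    ∏ i ∈ Finset.Icc 1 N, ((Real.exp (-((y * (√(N : ℝ) / N)) ^ 2 / 2
        * (drawProb a b α N U t i ω * (1 - drawProb a b α N U t i ω)))) : ℝ) : ℂ)
      = (Real.exp (-(y ^ 2 / 2 * average N fun i =>
        drawProb a b α N U t i ω * (1 - drawProb a b α N U t i ω))) : ℝ) := by
  rw [← Complex.ofReal_prod, ← Real.exp_sum, Finset.sum_neg_distrib, ← Finset.mul_sum, average]
  congr 3
  rcases Nat.eq_zero_or_pos N with rfl | hN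
  · simp
  have hN' : (N : ℝ) ≠ 0 := by positivity
  have h := sqrt_div_self_sq_mul N
  rw [if_neg hN.ne'] at h
  rw [mul_pow, eq_div_of_mul_eq hN' h]
  ring

variable [MeasurableSpace Ω] {P : Measure Ω} [IsProbabilityMeasure P]

/-- The increment of the fluctuation at time `t + 1` is asymptotically Gaussian with variance
`sigmaSq a b α t` and independent of the past. -/
lemma tendsto_integral_exp_fluctuation_succ (ha : 1 ≤ a) (hb : 1 ≤ b)
    (hα : α ∈ Set.Icc (0 : ℝ) 1) (hU_meas : ∀ t i, Measurable (U t i))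
    (hU_indep : iIndepFun (fun q : ℕ × ℕ => U q.1 q.2) P)
    (hU_law : ∀ t i, HasLaw (U t i) (volume.restrict (Set.Icc (0 : ℝ) 1)) P) (t : ℕ)
    {A : ℕ → Ω → ℂ}
    (hA : ∀ N, Measurable[generated (fun q : ℕ × ℕ => U q.1 q.2) (past t)] (A N))
    (hA1 : ∀ N ω, ‖A N ω‖ ≤ 1) (x : ℝ) :
    Tendsto (fun N => ∫ ω, A N ω * Complex.exp ((x * (fluctuation a b α N U (t + 1) ω
        - fluctuation a b α N U t ω) : ℝ) * Complex.I) ∂P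
      - (∫ ω, A N ω ∂P) * (Real.exp (-(x ^ 2 * sigmaSq a b α t / 2)) : ℝ)) atTop (𝓝 0) := by
  have hU : ∀ q : ℕ × ℕ, Measurable (U q.1 q.2) := fun q => hU_meas _ _
  set n : ℝ := (t : ℝ) + ((a : ℝ) + (b : ℝ)) + 1 with hn
  have hn0 : n ≠ 0 := by positivity
  set y : ℝ := x / n with hy
  set V : ℕ → Ω → ℝ := fun N ω => average N fun i =>
    drawProb a b α N U t i ω * (1 - drawProb a b α N U t i ω) with hV
  set v : ℝ := n ^ 2 * sigmaSq a b α t with hv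
  have hvar : TendstoInMean P V v :=
    tendstoInMean_variance ha hα hU_meas hU_indep hU_law t
  have hv0 : 0 ≤ v := mul_nonneg (sq_nonneg _) (sigmaSq_nonneg ha hb hα t)
  have hV0 : ∀ N ω, 0 ≤ V N ω := fun N ω =>
    (average_mem_Icc fun i => by
      obtain ⟨h0, h1⟩ := drawProb_mem_Icc (a := a) (b := b) (N := N) (U := U) hα t i ω
      exact ⟨mul_nonneg h0 (by linarith), by nlinarith⟩).1
  have hxv : x ^ 2 * sigmaSq a b α t / 2 = y ^ 2 / 2 * v := by
    rw [hy, hv]; field_simp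
  -- With `d = √N / N`, the first term is the cost `N * 6 |y d|^3` of replacing all Bernoulli
  -- factors by Gaussian ones, as `N d^2 = 1`. The second is the cost of replacing the random
  -- variance `V` by `v`.
  have hlim : Tendsto (fun N : ℕ => 6 * |y| ^ 3 * (√(N : ℝ) / N)
      + y ^ 2 / 2 * ∫ ω, |V N ω - v| ∂P) atTop (𝓝 0) := by
    simpa using (tendsto_sqrt_div_self.const_mul (6 * |y| ^ 3)).add
      (hvar.tendsto.const_mul (y ^ 2 / 2))
  have hsmall : ∀ᶠ N : ℕ in atTop, |y * (√(N : ℝ) / N)| ≤ 1 := by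
    have h := (tendsto_sqrt_div_self.const_mul y).abs
    simp only [mul_zero, abs_zero] at h
    exact h.eventually_le_const zero_lt_one
  refine squeeze_zero_norm' ?_ hlim
  filter_upwards [hsmall, eventually_gt_atTop 0] with N hθ hN
  set d : ℝ := √(N : ℝ) / N with hd
  have hd0 : 0 ≤ d := by positivity
  have hdN : d ^ 2 * N = 1 := by rw [hd, sqrt_div_self_sq_mul, if_neg hN.ne']
  have hAm : Measurable (A N) := (hA N).mono (generated_le hU) le_rfl
  have hpm : ∀ i, Measurable (drawProb a b α N U t i) := fun i =>
    (measurable_drawProb t i).mono (generated_le hU) le_rfl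
  have h1 : ∫ ω, A N ω * Complex.exp ((x * (fluctuation a b α N U (t + 1) ω
        - fluctuation a b α N U t ω) : ℝ) * Complex.I) ∂P
      = ∫ ω, A N ω * ∏ i ∈ Finset.Icc 1 N,
          bernoulliCharFun (drawProb a b α N U t i ω) (y * d) ∂P := by
    simp_rw [exp_fluctuation_succ ha]
    exact integral_mul_prod_exp_bernoulliNoise hU_meas hU_indep hU_law
      (p := drawProb a b α N U t) (measurable_drawProb t) (drawProb_mem_Icc hα t)
      (y * d) (Finset.Icc 1 N)
      ((hA N).mono (generated_mono (past_subset_pastExcept t _)) le_rfl) (hA1 N)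
  have hcf : Measurable fun r : ℝ => bernoulliCharFun r (y * d) := by
    unfold bernoulliCharFun; fun_prop
  have hcf1 : ∀ ω, ‖∏ i ∈ Finset.Icc 1 N,
      bernoulliCharFun (drawProb a b α N U t i ω) (y * d)‖ ≤ 1 := fun ω =>
    norm_prod_le_one _ _ fun i _ => norm_bernoulliCharFun_le (drawProb_mem_Icc hα t i ω) _
  have hi1 : Integrable (fun ω => A N ω * ∏ i ∈ Finset.Icc 1 N,
      bernoulliCharFun (drawProb a b α N U t i ω) (y * d)) P := by
    refine Integrable.of_bound (C := 1) (hAm.mul (Finset.measurable_fun_prod _ fun i _ =>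
      hcf.comp (hpm i))).aestronglyMeasurable (.of_forall fun ω => ?_)
    rw [norm_mul]
    exact mul_le_one₀ (hA1 N ω) (norm_nonneg _) (hcf1 ω)
  have hi2 : Integrable (A N) P :=
    Integrable.of_bound (C := 1) hAm.aestronglyMeasurable (.of_forall (hA1 N))
  have hbound : ∀ ω, ‖A N ω * (∏ i ∈ Finset.Icc 1 N,
      bernoulliCharFun (drawProb a b α N U t i ω) (y * d))
      - A N ω * (Real.exp (-(y ^ 2 / 2 * v)) : ℝ)‖
      ≤ 6 * |y| ^ 3 * d + y ^ 2 / 2 * |V N ω - v| := fun ω => by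
    have e1 : ‖∏ i ∈ Finset.Icc 1 N, bernoulliCharFun (drawProb a b α N U t i ω) (y * d)
        - (Real.exp (-(y ^ 2 / 2 * V N ω)) : ℝ)‖ ≤ 6 * |y| ^ 3 * d := by
      rw [hV, ← prod_exp_drawProb]
      refine (norm_prod_sub_prod_le _ _ _ (fun i _ => norm_bernoulliCharFun_le
        (drawProb_mem_Icc hα t i ω) _) fun i _ => ?_).trans ((Finset.sum_le_sum fun i _ =>
          norm_bernoulliCharFun_sub_le (drawProb_mem_Icc hα t i ω) hθ).trans (le_of_eq ?_))
      · obtain ⟨h0, h1⟩ := drawProb_mem_Icc (a := a) (b := b) (N := N) (U := U) hα t i ω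
        rw [Complex.norm_real, Real.norm_of_nonneg (Real.exp_pos _).le, Real.exp_le_one_iff,
          neg_nonpos]
        exact mul_nonneg (by positivity) (mul_nonneg h0 (sub_nonneg.2 h1))
      · rw [Finset.sum_const, Nat.card_Icc, add_tsub_cancel_right, nsmul_eq_mul, abs_mul,
          abs_of_nonneg hd0]
        linear_combination 6 * |y| ^ 3 * d * hdN
    have e2 : ‖((Real.exp (-(y ^ 2 / 2 * V N ω)) : ℝ) : ℂ)
        - (Real.exp (-(y ^ 2 / 2 * v)) : ℝ)‖ ≤ y ^ 2 / 2 * |V N ω - v| := by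
      rw [← Complex.ofReal_sub, Complex.norm_real, Real.norm_eq_abs]
      refine (abs_exp_neg_sub_exp_neg_le (mul_nonneg (by positivity) (hV0 N ω))
        (mul_nonneg (by positivity) hv0)).trans (le_of_eq ?_)
      rw [← mul_sub, abs_mul, abs_of_nonneg (by positivity : 0 ≤ y ^ 2 / 2)]
    rw [← mul_sub, norm_mul]
    refine (mul_le_of_le_one_left (norm_nonneg _) (hA1 N ω)).trans ?_
    exact (norm_sub_le_norm_sub_add_norm_sub _ _ _).trans (add_le_add e1 e2)
  rw [h1, hxv, ← integral_mul_const, ← integral_sub hi1 (hi2.mul_const _)]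
  have hi3 := hvar.integrable N
  calc _ ≤ ∫ ω, (6 * |y| ^ 3 * d + y ^ 2 / 2 * |V N ω - v|) ∂P :=
        norm_integral_le_of_norm_le ((integrable_const _).add (hi3.const_mul _))
          (.of_forall hbound)
    _ = _ := by
        rw [integral_add (integrable_const _) (hi3.const_mul _), integral_const,
          integral_const_mul]
        simp

/-- Moving the last weight back to time `t` isolates the final increment, on which the one-step
estimates act. -/
lemma sum_range_succ_eq_sum_add_mul_sub (ξ w : ℕ → ℝ) (t : ℕ) :
    ∑ s ∈ Finset.range (t + 2), ξ s * w s
      = ∑ s ∈ Finset.range (t + 1), (ξ s + if s = t then ξ (t + 1) else 0) * w s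
        + ξ (t + 1) * (w (t + 1) - w t) := by
  have h : ∑ s ∈ Finset.range (t + 1), (ξ s + if s = t then ξ (t + 1) else 0) * w s
      = ∑ s ∈ Finset.range (t + 1), ξ s * w s + ξ (t + 1) * w t := by
    simp only [add_mul, Finset.sum_add_distrib, ite_mul, zero_mul, Finset.sum_ite_eq',
      Finset.self_mem_range_succ, if_true]
  rw [h, Finset.sum_range_succ _ (t + 1)]
  ring

lemma exp_sum_succ (ξ w : ℕ → ℝ) (t : ℕ) :
    Complex.exp ((∑ s ∈ Finset.range (t + 2), ξ s * w s : ℝ) * Complex.I)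
      = Complex.exp ((∑ s ∈ Finset.range (t + 1),
          (ξ s + if s = t then ξ (t + 1) else 0) * w s : ℝ) * Complex.I)
        * Complex.exp ((ξ (t + 1) * (w (t + 1) - w t) : ℝ) * Complex.I) := by
  rw [sum_range_succ_eq_sum_add_mul_sub, Complex.ofReal_add, add_mul, Complex.exp_add]

/-- Convergence of the characteristic functions of the finite-dimensional distributions. -/
lemma tendsto_charFun_fluctuation {Ω' : Type*} [MeasurableSpace Ω'] {P' : Measure Ω'}
    [IsProbabilityMeasure P'] {B : ℕ → Ω' → ℝ} (ha : 1 ≤ a) (hb : 1 ≤ b)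
    (hα : α ∈ Set.Icc (0 : ℝ) 1) (hU_meas : ∀ t i, Measurable (U t i))
    (hU_indep : iIndepFun (fun q : ℕ × ℕ => U q.1 q.2) P)
    (hU_law : ∀ t i, HasLaw (U t i) (volume.restrict (Set.Icc (0 : ℝ) 1)) P)
    (hB_meas : ∀ t, 1 ≤ t → Measurable (B t))
    (hB_indep : iIndepFun (fun t : ℕ => B (t + 1)) P')
    (hB_law : ∀ t, 1 ≤ t → HasLaw (B t) (gaussianReal 0 1) P') (ξ : ℕ → ℝ) (t : ℕ) :
    Tendsto (fun N => ∫ ω, Complex.exp ((∑ s ∈ Finset.range (t + 1),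
        ξ s * fluctuation a b α N U s ω : ℝ) * Complex.I) ∂P) atTop
      (𝓝 (∫ ω, Complex.exp ((∑ s ∈ Finset.range (t + 1),
        ξ s * limitProcess a b α B s ω : ℝ) * Complex.I) ∂P')) := by
  induction t generalizing ξ with
  | zero => simp [fluctuation_zero, limitProcess]
  | succ t ih =>
    have hexp : Measurable fun r : ℝ => Complex.exp (r * Complex.I) := by fun_prop
    simp_rw [exp_sum_succ ξ (fun s => fluctuation a b α _ U s _),
      exp_sum_succ ξ (fun s => limitProcess a b α B s _)]
    -- The induction is over all weights at once, since its hypothesis is needed at `η` rather than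
    -- `ξ`.
    set η : ℕ → ℝ := fun s => ξ s + if s = t then ξ (t + 1) else 0 with hη
    have hA : ∀ N, Measurable[generated (fun q : ℕ × ℕ => U q.1 q.2) (past t)]
        fun ω => Complex.exp ((∑ s ∈ Finset.range (t + 1),
          η s * fluctuation a b α N U s ω : ℝ) * Complex.I) := fun N =>
      hexp.comp (Finset.measurable_fun_sum _ fun s hs =>
        (measurable_fluctuation (Nat.lt_succ_iff.1 (Finset.mem_range.1 hs))).const_mul (η s))
    have hA' : Measurable[generated (fun k => B (k + 1)) {k | k < t}]
        fun ω => Complex.exp ((∑ s ∈ Finset.range (t + 1),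
          η s * limitProcess a b α B s ω : ℝ) * Complex.I) :=
      hexp.comp (Finset.measurable_fun_sum _ fun s hs =>
        (measurable_generated_limitProcess
          (Nat.lt_succ_iff.1 (Finset.mem_range.1 hs))).const_mul (η s))
    have h1 := tendsto_integral_exp_fluctuation_succ ha hb hα hU_meas hU_indep hU_law t hA
      (fun N ω => (Complex.norm_exp_ofReal_mul_I _).le) (ξ (t + 1))
    have h2 := (ih η).mul_const
      (((Real.exp (-(ξ (t + 1) ^ 2 * sigmaSq a b α t / 2)) : ℝ) : ℂ))
    have h3 := h1.add h2
    simp only [sub_add_cancel, zero_add] at h3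
    rw [integral_exp_limitProcess_succ hB_meas hB_indep hB_law (sigmaSq_nonneg ha hb hα t) hA'
      (ξ (t + 1))]
    exact h3

end CharacteristicFunctions

end PolyaUrns

theorem theorem4p1
    (a b : ℕ) (ha : 1 ≤ a) (hb : 1 ≤ b) (α : ℝ) (hα : α ∈ Set.Icc (0 : ℝ) 1)
    {Ω : Type*} [MeasurableSpace Ω] (P : Measure Ω) [IsProbabilityMeasure P]
    (U : ℕ → ℕ → Ω → ℝ) (hU_meas : ∀ t i, Measurable (U t i))
    (hU_indep : iIndepFun (fun p : ℕ × ℕ => U p.1 p.2) P)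
    (hU_law : ∀ t i, HasLaw (U t i) (volume.restrict (Set.Icc (0 : ℝ) 1)) P)
    {Ω' : Type*} [MeasurableSpace Ω'] (P' : Measure Ω') [IsProbabilityMeasure P']
    (B : ℕ → Ω' → ℝ) (hB_meas : ∀ t, 1 ≤ t → Measurable (B t))
    (hB_indep : iIndepFun (fun t : ℕ => B (t + 1)) P')
    (hB_law : ∀ t, 1 ≤ t → HasLaw (B t) (gaussianReal 0 1) P') :
    (∀ t, 0 ≤ PolyaUrns.sigmaSq a b α t) ∧
    IsGaussianProcess (PolyaUrns.limitProcess a b α B) P' ∧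
    PolyaUrns.IsMarkovProcess (PolyaUrns.limitProcess a b α B) P' ∧
    TendstoInDistribution
      (fun (N : ℕ) (ω : Ω) (t : ℕ) => PolyaUrns.fluctuation a b α N U t ω)
      atTop
      (fun (ω : Ω') (t : ℕ) => PolyaUrns.limitProcess a b α B t ω)
      (fun _ => P) P' := by
  have hMarkov := PolyaUrns.isMarkovProcess_limitProcess (a := a) (b := b) (α := α)
    hB_meas hB_indep
  refine ⟨PolyaUrns.sigmaSq_nonneg ha hb hα,
    PolyaUrns.isGaussianProcess_limitProcess hB_indep hB_law, hMarkov,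
    PolyaUrns.tendstoInDistribution_of_tendsto_charFun
      (fun N => measurable_pi_lambda _ fun t => (PolyaUrns.measurable_fluctuation le_rfl).mono
        (PolyaUrns.generated_le fun q : ℕ × ℕ => hU_meas q.1 q.2) le_rfl)
      (measurable_pi_lambda _ hMarkov.1) fun ξ k => ?_⟩
  cases k with
  | zero => simp
  | succ t =>
    exact PolyaUrns.tendsto_charFun_fluctuation ha hb hα hU_meas hU_indep hU_law hB_meas
      hB_indep hB_law ξ t
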